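/- **Proposition 4 (Semi-bandit guarantees).** *Setting.* Let $K\subseteq[0,1]^d$ be closed, convex and down-closed ($y\in K$, $0\le x\le y$ coordinatewise imply $x\in K$), with $\|x-y\|\le D$ on $K$, $D>0$, and let $c\in K$, $r>0$ be such that the ball of radius $r$ around $c$ within $\mathrm{aff}(K)$ lies in $K$. Let $f_0,\dots,f_{T-1}$ be a fixed sequence (oblivious adversary) of non-negative, differentiable, not necessarily monotone functions on $[0,1]^d$ that are DR-submodular ($x\le y$ implies $\nabla f_t(x)\ge\nabla f_t(y)$ on $[0,1]^d$), and on $K$ are $M_1$-Lipschitz ($\|\nabla f_t\|\le M_1$) and smooth ($\nabla f_t$ is Lipschitz). In round $t$ the player plays $X_t$ and sees only $o_t$ with $\mathbb E[o_t\mid\text{past},X_t]=\nabla f_t(X_t)$ and $\|o_t\|\le B_1$, where $B_1>0$ (semi-bandit feedback: the query is the point played). *Algorithm.* Let $L=\lceil T^{1/3}\rceil$ and split the $T$ rounds into $Q=\lceil T/L\rceil$ consecutive blocks of length $L$, the last one cut off at round $T$. Fix $v>0$ and put $\delta=vQ^{-1/2}$, $\eta=\frac{vr}{2B_1}Q^{-1/2}$;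 assume $\delta<r$. Put $x_0=c$. In block $q$ draw, freshly and independently, $z_q\in[0,1]$ with density $e^{z-1}/(1-e^{-1})$ and a uniformly random permutation of the $L$ rounds of the block; let $\tau_q$ be its first entry. In round $\tau_q$ play $1-e^{-z_qx_q}$ (coordinatewise), and in the other rounds of the block play $1-e^{-x_q}$. Then put $x_{q+1}=\mathrm{IP}(x_q+\eta\, o_{\tau_q}\odot e^{-z_qx_q})$. Here $\mathrm{IP}$ is the infeasible projection by means of a (measurable) separation oracle, which for each $y\notin K$ returns $g$ with $\langle y-x,g\rangle>0$ for all $x\in K$: project the input to $\mathrm{aff}(K)$, then to the ball of radius $D$ around $c$; as long as the current point $y$ is not in $K$, replace it by $y-\delta g'/\|g'\|$, where $g'$ is the orthogonal projection of $g$ to $\mathrm{aff}(K)-c$; return the first point that lies in $K$. *Claim.* There is a constant $C$ that depends only on $D$, $r$, $v$ such that for all $T\ge1$ and all data as above with $\delta<r$, the points played lie in $K$ almost surely, the rewards $f_t(X_t)$ are integrable, and $$\frac1e\max_{y\in K}\sum_{t=0}^{T-1}f_t(y)-\sum_{t=0}^{T-1}\mathbb E[f_t(X_t)]\le C(M_1+B_1)\,T^{2/3},$$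 $$\max_{0\le a\le b<T}\Big(\frac1e\max_{y\in K}\sum_{t=a}^{b}f_t(y)-\sum_{t=a}^{b}\mathbb E[f_t(X_t)]\Big)\le C(M_1+B_1)\,T^{2/3}.$$ That is, the expected $1/e$-static regret and the $1/e$-adaptive regret are $O(T^{2/3})$. -/

import Mathlib

open MeasureTheory ProbabilityTheory

noncomputable section

/-- The cube `[0,1]^d` in Euclidean space. -/
def unitCube (d : ℕ) : Set (EuclideanSpace ℝ (Fin d)) :=
  {x | ∀ i, 0 ≤ x i ∧ x i ≤ 1}

/-- A closed convex down-closed set `K ⊆ [0,1]^d` all of whose pairwise distances are at most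
`D`. -/
structure IsConstraintSet {d : ℕ} (K : Set (EuclideanSpace ℝ (Fin d))) (D : ℝ) : Prop where
  isClosed : IsClosed K
  convex : Convex ℝ K
  subset_cube : K ⊆ unitCube d
  down_closed : ∀ y ∈ K, ∀ x : EuclideanSpace ℝ (Fin d), (∀ i, 0 ≤ x i ∧ x i ≤ y i) → x ∈ K
  dist_le : ∀ x ∈ K, ∀ y ∈ K, ‖x - y‖ ≤ D

/-- The gradient of a function on the cube (one-sided at the boundary of the cube). -/
def cubeGrad {d : ℕ} (f : EuclideanSpace ℝ (Fin d) → ℝ) (x : EuclideanSpace ℝ (Fin d)) :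
    EuclideanSpace ℝ (Fin d) :=
  gradientWithin f (unitCube d) x

/-- Non-negative differentiable (not necessarily monotone) DR-submodular functions on the cube
that are `M₁`-Lipschitz and `Λ`-smooth on `K`. Values outside the cube play no role. -/
structure IsObjective {d : ℕ} (K : Set (EuclideanSpace ℝ (Fin d))) (M₁ Λ : ℝ)
    (f : EuclideanSpace ℝ (Fin d) → ℝ) : Prop where
  nonneg : ∀ x ∈ unitCube d, 0 ≤ f x
  differentiable : DifferentiableOn ℝ f (unitCube d)
  dr_submodular : ∀ x ∈ unitCube d, ∀ y ∈ unitCube d, (∀ i, x i ≤ y i) →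
    ∀ i, cubeGrad f y i ≤ cubeGrad f x i
  lipschitz : ∀ x ∈ K, ‖cubeGrad f x‖ ≤ M₁
  smooth : ∀ x ∈ K, ∀ y ∈ K, ‖cubeGrad f x - cubeGrad f y‖ ≤ Λ * ‖x - y‖

/-! ### Online gradient ascent via a separation oracle -/

/-- A separation oracle for `K`: at every point outside `K` it returns the normal of a
hyperplane that strictly separates the point from `K`. -/
def IsSeparationOracle {d : ℕ} (K : Set (EuclideanSpace ℝ (Fin d)))
    (SO : EuclideanSpace ℝ (Fin d) → EuclideanSpace ℝ (Fin d)) : Prop :=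
  ∀ y, y ∉ K → ∀ x ∈ K, 0 < inner ℝ (y - x) (SO y)

/-- Start of the infeasible projection: the point is projected to the affine hull of `K` (which
is `c + vectorSpan ℝ K` for `c ∈ K`), and then to the ball of radius `D` around `c`. -/
def soIPStart {d : ℕ} (K : Set (EuclideanSpace ℝ (Fin d))) (c : EuclideanSpace ℝ (Fin d))
    (D : ℝ) (y₀ : EuclideanSpace ℝ (Fin d)) : EuclideanSpace ℝ (Fin d) :=
  let y₁ := c + (vectorSpan ℝ K).starProjection (y₀ - c)
  c + (max 1 (‖y₁ - c‖ / D))⁻¹ • (y₁ - c)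

/-- One step of length `δ` along the (projected) separating direction, towards `K`. -/
def soIPStep {d : ℕ} (K : Set (EuclideanSpace ℝ (Fin d)))
    (SO : EuclideanSpace ℝ (Fin d) → EuclideanSpace ℝ (Fin d)) (δ : ℝ)
    (y : EuclideanSpace ℝ (Fin d)) : EuclideanSpace ℝ (Fin d) :=
  let g := (vectorSpan ℝ K).starProjection (SO y)
  y - (δ / ‖g‖) • g

open Classical in
/-- The infeasible projection: iterate the step until the first point in `K`, and return it.
(If `K` is never reached, the value is the starting point.) -/
def soIP {d : ℕ} (K : Set (EuclideanSpace ℝ (Fin d))) (c : EuclideanSpace ℝ (Fin d)) (D : ℝ)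
    (SO : EuclideanSpace ℝ (Fin d) → EuclideanSpace ℝ (Fin d)) (δ : ℝ)
    (y₀ : EuclideanSpace ℝ (Fin d)) : EuclideanSpace ℝ (Fin d) :=
  if h : ∃ n : ℕ, (soIPStep K SO δ)^[n] (soIPStart K c D y₀) ∈ K then
    (soIPStep K SO δ)^[Nat.find h] (soIPStart K c D y₀)
  else soIPStart K c D y₀

/-- One update of the online gradient ascent: a gradient step of size `η` from `x` along `g`,
followed by the infeasible projection. -/
def soOGAStep {d : ℕ} (K : Set (EuclideanSpace ℝ (Fin d))) (c : EuclideanSpace ℝ (Fin d))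
    (D : ℝ) (SO : EuclideanSpace ℝ (Fin d) → EuclideanSpace ℝ (Fin d)) (δ η : ℝ)
    (x g : EuclideanSpace ℝ (Fin d)) : EuclideanSpace ℝ (Fin d) :=
  soIP K c D SO δ (x + η • g)

/-! ### The query algorithm -/

/-- `h_z(x) = 1 - e^{-z x}`, coordinatewise. -/
def expMap {d : ℕ} (z : ℝ) (x : EuclideanSpace ℝ (Fin d)) : EuclideanSpace ℝ (Fin d) :=
  WithLp.toLp 2 fun i => 1 - Real.exp (-(z * x i))

/-- The law of the scalar `z`: density `e^{z-1} / (1 - e^{-1})` on `[0,1]`. -/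
def bqndLaw : Measure ℝ :=
  (volume.restrict (Set.Icc (0 : ℝ) 1)).withDensity
    fun z => ENNReal.ofReal (Real.exp (z - 1) / (1 - Real.exp (-1)))

/-- The estimator `v ⊙ e^{-z x}`, where `v` is the answer of the oracle to the query
`1 - e^{-z x}`. -/
def bqndEstimate {d : ℕ} (z : ℝ) (x v : EuclideanSpace ℝ (Fin d)) :
    EuclideanSpace ℝ (Fin d) :=
  WithLp.toLp 2 fun i => v i * Real.exp (-(z * x i))

/-! ### The blocking meta-algorithm

Rounds and blocks are numbered from `0`: block `q` consists of the rounds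
`q * L, …, q * L + L - 1`, so that round `t` lies in block `t / L`. -/

/-- Block size: `T^{1/3}`, rounded up. -/
def blockSize (T : ℕ) : ℕ := ⌈(T : ℝ) ^ (1 / 3 : ℝ)⌉₊

lemma blockSize_pos {T : ℕ} (hT : 1 ≤ T) : 0 < blockSize T := by
  have h : (0 : ℝ) < T := by exact_mod_cast hT
  exact Nat.ceil_pos.2 (Real.rpow_pos_of_pos h _)

/-- Number of blocks, which is the horizon of the base algorithm: `T / L`, rounded up. (The last
block is cut off after the last round.) -/
def numBlocks (T : ℕ) : ℕ := ⌈(T : ℝ) / blockSize T⌉₊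

/-- The round of block `q` in which the one query of this block is played: the first entry of
the permutation `π q` of the rounds of the block. -/
def queryRound {L : ℕ} (hL : 0 < L) (π : ℕ → Equiv.Perm (Fin L)) (q : ℕ) : ℕ :=
  q * L + (π q ⟨0, hL⟩ : Fin L)

/-- The iterates of the base learner, one per block, as a function of the scalars `z q`, of the
permutations `π q` and of the feedback `o t` of the rounds. The only feedback used in block `q`
is that of its query round. -/
def baseIterate {d : ℕ} (K : Set (EuclideanSpace ℝ (Fin d))) (c : EuclideanSpace ℝ (Fin d))
    (D : ℝ) (SO : EuclideanSpace ℝ (Fin d) → EuclideanSpace ℝ (Fin d)) (δ η : ℝ)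
    {L : ℕ} (hL : 0 < L) (z : ℕ → ℝ) (π : ℕ → Equiv.Perm (Fin L))
    (o : ℕ → EuclideanSpace ℝ (Fin d)) : ℕ → EuclideanSpace ℝ (Fin d)
  | 0 => c
  | q + 1 =>
    let x := baseIterate K c D SO δ η hL z π o q
    soOGAStep K c D SO δ η x (bqndEstimate (z q) x (o (queryRound hL π q)))

/-- The point played in round `t`, in block `q = t / L`: the query `1 - e^{-z_q x_q}` in the
query round of the block, and the action `1 - e^{-x_q}` in its other rounds. -/
def playedAction {d : ℕ} (K : Set (EuclideanSpace ℝ (Fin d))) (c : EuclideanSpace ℝ (Fin d))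
    (D : ℝ) (SO : EuclideanSpace ℝ (Fin d) → EuclideanSpace ℝ (Fin d)) (δ η : ℝ)
    {L : ℕ} (hL : 0 < L) (z : ℕ → ℝ) (π : ℕ → Equiv.Perm (Fin L))
    (o : ℕ → EuclideanSpace ℝ (Fin d)) (t : ℕ) : EuclideanSpace ℝ (Fin d) :=
  if t = queryRound hL π (t / L) then
    expMap (z (t / L)) (baseIterate K c D SO δ η hL z π o (t / L))
  else
    expMap 1 (baseIterate K c D SO δ η hL z π o (t / L))

/-! ### The interaction with the adversary -/

/-- What is known before block `q` starts: the scalars and permutations of the earlier blocks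
and the feedback of the earlier rounds. -/
@[reducible] def blockHistory {d L : ℕ} {Ω : Type*} (z : ℕ → Ω → ℝ) (π : ℕ → Ω → Equiv.Perm (Fin L))
    (o : ℕ → Ω → EuclideanSpace ℝ (Fin d)) (q : ℕ) : MeasurableSpace Ω :=
  (⨆ j : Fin q, MeasurableSpace.comap (z j) inferInstance) ⊔
  (⨆ j : Fin q, MeasurableSpace.comap (π j) ⊤) ⊔
  (⨆ t : Fin (q * L), MeasurableSpace.comap (o t) inferInstance)

/-- What is known when the point of round `t` has been played and before its feedback arrives:
the scalars and permutations of the blocks up to the current one and the feedback of the earlier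
rounds. -/
@[reducible] def roundHistory {d L : ℕ} {Ω : Type*} (z : ℕ → Ω → ℝ) (π : ℕ → Ω → Equiv.Perm (Fin L))
    (o : ℕ → Ω → EuclideanSpace ℝ (Fin d)) (t : ℕ) : MeasurableSpace Ω :=
  (⨆ j : Fin (t / L + 1), MeasurableSpace.comap (z j) inferInstance) ⊔
  (⨆ j : Fin (t / L + 1), MeasurableSpace.comap (π j) ⊤) ⊔
  (⨆ s : Fin t, MeasurableSpace.comap (o s) inferInstance)

/-- A run with horizon `T`, under semi-bandit feedback, of a player who plays `X t` in round `t`: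
in every block fresh random coins `z q` and `π q` are drawn, and the feedback `o t` of round `t`
is a conditionally unbiased estimate, bounded by `B₁`, of the gradient of `f t` at the very point
that is played. -/
structure IsSemiBanditRun {d L : ℕ} {Ω : Type*} [MeasurableSpace Ω] (P : Measure Ω) (T : ℕ)
    (B₁ : ℝ) (f : ℕ → EuclideanSpace ℝ (Fin d) → ℝ) (z : ℕ → Ω → ℝ)
    (π : ℕ → Ω → Equiv.Perm (Fin L)) (o : ℕ → Ω → EuclideanSpace ℝ (Fin d))
    (X : ℕ → Ω → EuclideanSpace ℝ (Fin d)) : Prop where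
  measurable_z : ∀ q, q * L < T → Measurable (z q)
  measurable_perm : ∀ q, q * L < T → ∀ p, MeasurableSet {ω | π q ω = p}
  measurable_feedback : ∀ t < T, Measurable (o t)
  law_z : ∀ q, q * L < T → Measure.map (z q) P = bqndLaw
  law_perm : ∀ q, q * L < T → ∀ p, P {ω | π q ω = p} = ((L.factorial : ℕ) : ENNReal)⁻¹
  indep_z : ∀ q, q * L < T →
    Indep (MeasurableSpace.comap (z q) inferInstance) (blockHistory z π o q) P
  indep_perm : ∀ q, q * L < T →
    Indep (MeasurableSpace.comap (π q) ⊤)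
      (blockHistory z π o q ⊔ MeasurableSpace.comap (z q) inferInstance) P
  unbiased : ∀ t < T, P[o t | roundHistory z π o t] =ᵐ[P] fun ω => cubeGrad (f t) (X t ω)
  bounded : ∀ t < T, ∀ᵐ ω ∂P, ‖o t ω‖ ≤ B₁

/-! ### Regret -/

/-- `α`-regret over a set `I` of rounds:
`α max_{y ∈ K} ∑_{t ∈ I} f_t(y) - ∑_{t ∈ I} 𝔼[f_t(x_t)]`. -/
def regretOn {d : ℕ} {Ω : Type*} [MeasurableSpace Ω] (P : Measure Ω) (α : ℝ)
    (K : Set (EuclideanSpace ℝ (Fin d))) (f : ℕ → EuclideanSpace ℝ (Fin d) → ℝ)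
    (X : ℕ → Ω → EuclideanSpace ℝ (Fin d)) (I : Finset ℕ) : ℝ :=
  α * sSup ((fun y => ∑ t ∈ I, f t y) '' K) - ∑ t ∈ I, ∫ ω, f t (X t ω) ∂P

/-- Static `α`-regret over the rounds `0, …, T - 1`. -/
def staticRegret {d : ℕ} {Ω : Type*} [MeasurableSpace Ω] (P : Measure Ω) (α : ℝ)
    (K : Set (EuclideanSpace ℝ (Fin d))) (f : ℕ → EuclideanSpace ℝ (Fin d) → ℝ)
    (X : ℕ → Ω → EuclideanSpace ℝ (Fin d)) (T : ℕ) : ℝ :=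
  regretOn P α K f X (Finset.range T)

/-- Adaptive `α`-regret: the largest regret over an interval of the rounds `0, …, T - 1`. -/
def adaptiveRegret {d : ℕ} {Ω : Type*} [MeasurableSpace Ω] (P : Measure Ω) (α : ℝ)
    (K : Set (EuclideanSpace ℝ (Fin d))) (f : ℕ → EuclideanSpace ℝ (Fin d) → ℝ)
    (X : ℕ → Ω → EuclideanSpace ℝ (Fin d)) (T : ℕ) : ℝ :=
  sSup {ρ | ∃ a b : ℕ, a ≤ b ∧ b < T ∧ ρ = regretOn P α K f X (Finset.Icc a b)}

end

/-!
The infeasible projection never moves its input away from a point with margin `δ` in `K`: each of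
its steps, of length `δ` along the separating direction, gains `δ²` in the squared distance. Every
`y ∈ K` is within `Dδ / r` of such a point, namely a convex combination of `y` and `c`, so the usual
telescoping argument for online gradient ascent bounds the linear regret over any interval of `N`
blocks by `D² / (2η) + N (ηB² / 2 + BDδ / r)`.

A non-negative DR-submodular `f` satisfies
`e^{-z} f(y) - f(h_z x) ≤ ⟪∇f(h_z x), e^{-zx} ⊙ (y - x)⟫ + d/dz f(h_z x)` for
`h_z x = 1 - e^{-zx}`. Integrated against `e^{z-1}` over `[0,1]`, this bounds
`e⁻¹ f(y) - f(h_1 x)` by `1 - e⁻¹` times the expectation of the first term under the law of `z`.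
Since the query round is uniform in its block and independent of the past, `L` times the gradient
estimate observed there is unbiased for the sum over the block, which reduces a block to one round
of linear optimisation.

The query rounds and the rounds of an interval outside its complete blocks cost at most `M₁ D`
each, and the block length `L ≈ T^{1/3}` balances these losses against `L` times the linear regret
of order `√(T / L)`.
-/

noncomputable section

section Margin

variable {E : Type*} [NormedAddCommGroup E]

/-- The point `u` has a margin `δ` in `K`: the relatively open ball of radius `δ` around `u`, in
the directions of the affine hull of `K`, lies in `K`. These are the comparison points to which the
infeasible projection does not increase the distance. -/
def HasMargin [NormedSpace ℝ E] (K : Set E) (δ : ℝ) (u : E) : Prop :=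
  ∀ w ∈ vectorSpan ℝ K, ‖w‖ < δ → u + w ∈ K

lemma sub_mem_vectorSpan [NormedSpace ℝ E] {K : Set E} {x y : E} (hx : x ∈ K) (hy : y ∈ K) :
    x - y ∈ vectorSpan ℝ K := by
  simpa using vsub_mem_vectorSpan ℝ hx hy

lemma hasMargin_of_ball_inter_affineSpan_subset [NormedSpace ℝ E] {K : Set E} {c : E} {r : ℝ}
    (hc : c ∈ K) (hball : Metric.ball c r ∩ (affineSpan ℝ K : Set E) ⊆ K) : HasMargin K r c := by
  intro w hw hwr
  refine hball ⟨by simpa [dist_eq_norm] using hwr, ?_⟩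
  have h := AffineSubspace.vadd_mem_of_mem_direction
    (by rwa [direction_affineSpan] : w ∈ (affineSpan ℝ K).direction) (mem_affineSpan ℝ hc)
  simpa [add_comm] using h

namespace HasMargin

lemma mem [NormedSpace ℝ E] {K : Set E} {δ : ℝ} {u : E} (h : HasMargin K δ u) (hδ : 0 < δ) :
    u ∈ K := by
  simpa using h 0 (Submodule.zero_mem _) (by simpa using hδ)

lemma mono [NormedSpace ℝ E] {K : Set E} {δ r : ℝ} {u : E} (h : HasMargin K r u) (hδr : δ ≤ r) :
    HasMargin K δ u :=
  fun w hw hwδ => h w hw (hwδ.trans_le hδr)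

lemma add_smul_sub [NormedSpace ℝ E] {K : Set E} {c y : E} {δ r : ℝ} (h : HasMargin K r c)
    (hK : Convex ℝ K) (hδ : 0 < δ) (hδr : δ ≤ r) (hy : y ∈ K) :
    HasMargin K δ (y + (δ / r) • (c - y)) := by
  intro w hw hwδ
  have hr : 0 < r := hδ.trans_le hδr
  have hmem : c + (r / δ) • w ∈ K := h _ (Submodule.smul_mem _ _ hw) (by
    rw [norm_smul, Real.norm_of_nonneg (by positivity), div_mul_eq_mul_div, div_lt_iff₀ hδ]
    gcongr)
  have hcomb := hK hy hmem (a := 1 - δ / r) (b := δ / r)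
    (by rw [sub_nonneg, div_le_one hr]; exact hδr) (by positivity) (by ring)
  have hw' : (δ / r) • (r / δ) • w = w := by
    rw [smul_smul, div_mul_div_cancel₀ hr.ne', div_self hδ.ne', one_smul]
  convert hcomb using 1
  rw [smul_add, hw']
  module

lemma mul_norm_le_inner [InnerProductSpace ℝ E] {K : Set E} {δ : ℝ} {u g y : E}
    (h : HasMargin K δ u) (hδ : 0 < δ) (hg : g ∈ vectorSpan ℝ K)
    (hy : ∀ x ∈ K, 0 ≤ inner ℝ (y - x) g) : δ * ‖g‖ ≤ inner ℝ (y - u) g := by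
  rcases eq_or_ne g 0 with rfl | hg0
  · simp
  have hpos : 0 < ‖g‖ := norm_pos_iff.2 hg0
  rw [← le_div_iff₀ hpos]
  refine le_of_forall_lt_imp_le_of_dense fun s hs => ?_
  rcases le_total s 0 with hs0 | hs0
  · exact hs0.trans (div_nonneg (hy u (h.mem hδ)) hpos.le)
  have hmem : u + (s / ‖g‖) • g ∈ K := h _ (Submodule.smul_mem _ _ hg) (by
    rwa [norm_smul, Real.norm_of_nonneg (by positivity), div_mul_cancel₀ _ hpos.ne'])
  have hsep := hy _ hmem
  rw [← sub_sub, inner_sub_left, inner_smul_left, real_inner_self_eq_norm_sq,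
    RCLike.conj_to_real, sub_nonneg, sq, ← mul_assoc, div_mul_cancel₀ _ hpos.ne'] at hsep
  rwa [le_div_iff₀ hpos]

end HasMargin

end Margin

section InfeasibleProjection

lemma norm_smul_sub_le_of_norm_le {E : Type*} [NormedAddCommGroup E] [InnerProductSpace ℝ E]
    {D : ℝ} (hD : 0 < D) (w : E) {u : E} (hu : ‖u‖ ≤ D) :
    ‖(max 1 (‖w‖ / D))⁻¹ • w - u‖ ≤ ‖w - u‖ := by
  rcases le_total (‖w‖ / D) 1 with h | h
  · simp [max_eq_left h]
  rw [max_eq_right h]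
  obtain ⟨l, hl⟩ : ∃ l, l = ‖w‖ / D := ⟨_, rfl⟩
  obtain ⟨p, hp⟩ : ∃ p, p = l⁻¹ • w := ⟨_, rfl⟩
  have hl0 : 0 < l := by linarith
  have hw : w = l • p := by rw [hp, smul_inv_smul₀ hl0.ne']
  have hpD : ‖p‖ = D := by
    rw [hp, norm_smul, norm_inv, Real.norm_of_nonneg hl0.le, inv_mul_eq_iff_eq_mul₀ hl0.ne', hl,
      div_mul_cancel₀ _ hD.ne']
  have hinner : inner ℝ p u ≤ D ^ 2 :=
    (real_inner_le_norm p u).trans (by rw [hpD, sq]; gcongr)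
  -- `w` is further out than `p` on the same ray, and `p - u` makes an acute angle with the ray
  have hsplit : ‖w - u‖ ^ 2 = ‖p - u‖ ^ 2 + 2 * ((l - 1) * (D ^ 2 - inner ℝ p u))
      + ‖(l - 1) • p‖ ^ 2 := by
    have hwu : w - u = (p - u) + (l - 1) • p := by rw [hw]; module
    rw [hwu, norm_add_sq_real, inner_smul_right, inner_sub_left, real_inner_self_eq_norm_sq, hpD,
      real_inner_comm]
  have hangle : 0 ≤ (l - 1) * (D ^ 2 - inner ℝ p u) :=
    mul_nonneg (by linarith) (by linarith)
  rw [← hl, ← hp]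
  refine le_of_sq_le_sq ?_ (norm_nonneg _)
  linarith [sq_nonneg ‖(l - 1) • p‖]

lemma norm_sub_smul_sub_sq_le {E : Type*} [NormedAddCommGroup E] [InnerProductSpace ℝ E]
    {δ : ℝ} (hδ : 0 ≤ δ) {y u g : E} (hg : g ≠ 0) (h : δ * ‖g‖ ≤ inner ℝ (y - u) g) :
    ‖y - (δ / ‖g‖) • g - u‖ ^ 2 ≤ ‖y - u‖ ^ 2 - δ ^ 2 := by
  have hpos : 0 < ‖g‖ := norm_pos_iff.2 hg
  have hnorm : ‖(δ / ‖g‖) • g‖ = δ := by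
    rw [norm_smul, Real.norm_of_nonneg (by positivity), div_mul_cancel₀ _ hpos.ne']
  have hprod : δ ^ 2 ≤ δ / ‖g‖ * inner ℝ (y - u) g := by
    rw [div_mul_eq_mul_div, le_div_iff₀ hpos, sq, mul_assoc]
    gcongr
  rw [sub_right_comm, norm_sub_sq_real, inner_smul_right, hnorm]
  linarith

variable {d : ℕ} {K : Set (EuclideanSpace ℝ (Fin d))} {c : EuclideanSpace ℝ (Fin d)}
  {SO : EuclideanSpace ℝ (Fin d) → EuclideanSpace ℝ (Fin d)} {D δ r : ℝ}

lemma soIPStart_sub_mem (y₀ : EuclideanSpace ℝ (Fin d)) :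
    soIPStart K c D y₀ - c ∈ vectorSpan ℝ K := by
  simp only [soIPStart, add_sub_cancel_left]
  exact Submodule.smul_mem _ _ (Submodule.starProjection_apply_mem _ _)

lemma iterate_soIPStep_sub_mem {y : EuclideanSpace ℝ (Fin d)} (hy : y - c ∈ vectorSpan ℝ K)
    (n : ℕ) : (soIPStep K SO δ)^[n] y - c ∈ vectorSpan ℝ K := by
  induction n with
  | zero => simpa using hy
  | succ n ih =>
    rw [Function.iterate_succ_apply', soIPStep, sub_right_comm]
    exact Submodule.sub_mem _ ih
      (Submodule.smul_mem _ _ (Submodule.starProjection_apply_mem _ _))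

lemma norm_soIPStart_sub_le (hD : 0 < D) (y₀ : EuclideanSpace ℝ (Fin d))
    {u : EuclideanSpace ℝ (Fin d)} (hu : u - c ∈ vectorSpan ℝ K) (huD : ‖u - c‖ ≤ D) :
    ‖soIPStart K c D y₀ - u‖ ≤ ‖y₀ - u‖ := by
  let w := (vectorSpan ℝ K).starProjection (y₀ - c)
  have hw : w - (u - c) = (vectorSpan ℝ K).starProjection (y₀ - u) := by
    rw [← sub_sub_sub_cancel_right y₀ u c, map_sub, Submodule.starProjection_eq_self_iff.2 hu]
  calc ‖soIPStart K c D y₀ - u‖ = ‖(max 1 (‖w‖ / D))⁻¹ • w - (u - c)‖ := by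
        simp only [soIPStart, add_sub_cancel_left, w]
        congr 1
        abel
    _ ≤ ‖w - (u - c)‖ := norm_smul_sub_le_of_norm_le hD w huD
    _ ≤ ‖y₀ - u‖ := hw ▸ Submodule.norm_starProjection_apply_le _ _

lemma IsSeparationOracle.inner_starProjection_pos (hSO : IsSeparationOracle K SO) (hc : c ∈ K)
    {y : EuclideanSpace ℝ (Fin d)} (hyc : y - c ∈ vectorSpan ℝ K) (hy : y ∉ K)
    {x : EuclideanSpace ℝ (Fin d)} (hx : x ∈ K) :
    0 < inner ℝ (y - x) ((vectorSpan ℝ K).starProjection (SO y)) := by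
  have hyx : y - x ∈ vectorSpan ℝ K := by
    rw [← sub_sub_sub_cancel_right y x c]
    exact Submodule.sub_mem _ hyc (sub_mem_vectorSpan hx hc)
  rw [← Submodule.inner_starProjection_left_eq_right,
    Submodule.starProjection_eq_self_iff.2 hyx]
  exact hSO y hy x hx

lemma norm_soIPStep_sub_sq_le (hSO : IsSeparationOracle K SO) (hδ : 0 < δ) (hc : c ∈ K)
    {y u : EuclideanSpace ℝ (Fin d)} (hyc : y - c ∈ vectorSpan ℝ K) (hy : y ∉ K)
    (hu : HasMargin K δ u) :
    ‖soIPStep K SO δ y - u‖ ^ 2 ≤ ‖y - u‖ ^ 2 - δ ^ 2 := by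
  have hpos {x} (hx : x ∈ K) := hSO.inner_starProjection_pos hc hyc hy hx
  refine norm_sub_smul_sub_sq_le hδ.le (fun h0 => ?_) <|
    hu.mul_norm_le_inner hδ (Submodule.starProjection_apply_mem _ _) fun x hx => (hpos hx).le
  simpa [h0] using hpos hc

lemma exists_iterate_soIPStep_mem (hSO : IsSeparationOracle K SO) (hδ : 0 < δ)
    (hc : HasMargin K δ c) {y : EuclideanSpace ℝ (Fin d)} (hy : y - c ∈ vectorSpan ℝ K) :
    ∃ n : ℕ, (soIPStep K SO δ)^[n] y ∈ K := by
  by_contra! hout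
  have hdecrease : ∀ n : ℕ, ‖(soIPStep K SO δ)^[n] y - c‖ ^ 2 ≤ ‖y - c‖ ^ 2 - n * δ ^ 2 := by
    intro n
    induction n with
    | zero => simp
    | succ n ih =>
      have hstep := norm_soIPStep_sub_sq_le hSO hδ (hc.mem hδ) (iterate_soIPStep_sub_mem hy n)
        (hout n) hc
      rw [Function.iterate_succ_apply']
      push_cast
      linarith
  obtain ⟨n, hn⟩ := exists_nat_gt (‖y - c‖ ^ 2 / δ ^ 2)
  rw [div_lt_iff₀ (by positivity)] at hn
  linarith [hdecrease n, sq_nonneg ‖(soIPStep K SO δ)^[n] y - c‖]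

lemma exists_iterate_soIPStart_mem (hSO : IsSeparationOracle K SO) (hδ : 0 < δ)
    (hc : HasMargin K δ c) (y₀ : EuclideanSpace ℝ (Fin d)) :
    ∃ n : ℕ, (soIPStep K SO δ)^[n] (soIPStart K c D y₀) ∈ K :=
  exists_iterate_soIPStep_mem hSO hδ hc (soIPStart_sub_mem y₀)

lemma soIP_mem (hSO : IsSeparationOracle K SO) (hδ : 0 < δ) (hc : HasMargin K δ c)
    (y₀ : EuclideanSpace ℝ (Fin d)) : soIP K c D SO δ y₀ ∈ K := by
  classical
  have h := exists_iterate_soIPStart_mem (D := D) hSO hδ hc y₀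
  rw [soIP, dif_pos h]
  exact Nat.find_spec h

lemma norm_iterate_soIPStep_sub_le (hSO : IsSeparationOracle K SO) (hδ : 0 < δ) (hc : c ∈ K)
    {y u : EuclideanSpace ℝ (Fin d)} (hyc : y - c ∈ vectorSpan ℝ K) (hu : HasMargin K δ u) {n : ℕ}
    (hout : ∀ m < n, (soIPStep K SO δ)^[m] y ∉ K) :
    ‖(soIPStep K SO δ)^[n] y - u‖ ≤ ‖y - u‖ := by
  induction n with
  | zero => simp
  | succ n ih =>
    refine le_trans ?_ (ih fun m hm => hout m (hm.trans n.lt_succ_self))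
    have hstep := norm_soIPStep_sub_sq_le hSO hδ hc (iterate_soIPStep_sub_mem hyc n)
      (hout n n.lt_succ_self) hu
    rw [Function.iterate_succ_apply']
    exact le_of_sq_le_sq (hstep.trans (sub_le_self _ (sq_nonneg δ))) (norm_nonneg _)

lemma norm_soIP_sub_le (hSO : IsSeparationOracle K SO) (hD : 0 < D) (hδ : 0 < δ) (hc : c ∈ K)
    {u : EuclideanSpace ℝ (Fin d)} (huD : ‖u - c‖ ≤ D) (hu : HasMargin K δ u)
    (y₀ : EuclideanSpace ℝ (Fin d)) : ‖soIP K c D SO δ y₀ - u‖ ≤ ‖y₀ - u‖ := by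
  have hstart : ‖soIPStart K c D y₀ - u‖ ≤ ‖y₀ - u‖ :=
    norm_soIPStart_sub_le hD y₀ (sub_mem_vectorSpan (hu.mem hδ) hc) huD
  classical
  unfold soIP
  split_ifs with h
  · exact (norm_iterate_soIPStep_sub_le hSO hδ hc (soIPStart_sub_mem y₀) hu
      fun m hm => Nat.find_min h hm).trans hstart
  · exact hstart

lemma measurable_soIPStart : Measurable (soIPStart K c D) := by
  unfold soIPStart
  fun_prop

lemma measurable_soIPStep (hSO : Measurable SO) : Measurable (soIPStep K SO δ) := by
  unfold soIPStep
  fun_prop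

lemma measurable_soIP (hK : MeasurableSet K) (hSO : IsSeparationOracle K SO)
    (hSOm : Measurable SO) (hδ : 0 < δ) (hc : HasMargin K δ c) :
    Measurable (soIP K c D SO δ) := by
  classical
  have hiter (n : ℕ) : Measurable fun y => (soIPStep K SO δ)^[n] (soIPStart K c D y) :=
    ((measurable_soIPStep hSOm).iterate n).comp measurable_soIPStart
  have hfind := Measurable.find hiter
    (p := fun n y => (soIPStep K SO δ)^[n] (soIPStart K c D y) ∈ K)
    (fun n => hiter n hK) (exists_iterate_soIPStart_mem hSO hδ hc)
  convert hfind using 2 with y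
  rw [soIP, dif_pos (exists_iterate_soIPStart_mem hSO hδ hc y)]

end InfeasibleProjection

section OnlineGradientAscent

variable {E : Type*} [NormedAddCommGroup E] [InnerProductSpace ℝ E]

lemma two_mul_inner_le_of_norm_sub_le {η : ℝ} {x g u x' : E} (h : ‖x' - u‖ ≤ ‖x + η • g - u‖) :
    2 * η * inner ℝ g (u - x) ≤ ‖x - u‖ ^ 2 - ‖x' - u‖ ^ 2 + η ^ 2 * ‖g‖ ^ 2 := by
  have hsq : ‖x' - u‖ ^ 2 ≤ ‖η • g - (u - x)‖ ^ 2 := by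
    rw [show η • g - (u - x) = x + η • g - u by abel]
    gcongr
  rw [norm_sub_sq_real (η • g), inner_smul_left, norm_smul, mul_pow, Real.norm_eq_abs, sq_abs,
    norm_sub_rev u x, RCLike.conj_to_real] at hsq
  linarith

lemma sum_inner_sub_le_of_norm_sub_le {x g : ℕ → E} {u : E} {η D B : ℝ} (hη : 0 < η) {m n : ℕ}
    (hmn : m ≤ n) (hx : ‖x m - u‖ ≤ D) (hg : ∀ q ∈ Finset.Ico m n, ‖g q‖ ≤ B)
    (hstep : ∀ q ∈ Finset.Ico m n, ‖x (q + 1) - u‖ ≤ ‖x q + η • g q - u‖) :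
    ∑ q ∈ Finset.Ico m n, inner ℝ (g q) (u - x q) ≤
      D ^ 2 / (2 * η) + (n - m : ℕ) * (η * B ^ 2 / 2) := by
  have hround : ∀ q ∈ Finset.Ico m n, inner ℝ (g q) (u - x q) ≤
      (‖x q - u‖ ^ 2 - ‖x (q + 1) - u‖ ^ 2) / (2 * η) + η * B ^ 2 / 2 := by
    intro q hq
    have hnorm : ‖g q‖ ^ 2 ≤ B ^ 2 := by gcongr; exact hg q hq
    have h := two_mul_inner_le_of_norm_sub_le (hstep q hq)
    rw [div_add' _ _ _ (by positivity), le_div_iff₀ (by positivity)]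
    nlinarith [mul_le_mul_of_nonneg_left hnorm (sq_nonneg η)]
  have htelescope : ∑ q ∈ Finset.Ico m n, (‖x q - u‖ ^ 2 - ‖x (q + 1) - u‖ ^ 2) ≤ D ^ 2 := by
    have hsq : ‖x m - u‖ ^ 2 ≤ D ^ 2 := by gcongr
    have hsum := Finset.sum_Ico_sub (f := fun q => -‖x q - u‖ ^ 2) hmn
    simp only [neg_sub_neg] at hsum
    linarith [sq_nonneg ‖x n - u‖]
  refine (Finset.sum_le_sum hround).trans ?_
  rw [Finset.sum_add_distrib, ← Finset.sum_div, Finset.sum_const, Nat.card_Ico, nsmul_eq_mul]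
  gcongr

lemma inner_sub_le_inner_add_smul_sub {g x y c : E} {s B D : ℝ} (hs : 0 ≤ s) (hg : ‖g‖ ≤ B)
    (hy : ‖y - c‖ ≤ D) :
    inner ℝ g (y - x) ≤ inner ℝ g (y + s • (c - y) - x) + B * (s * D) := by
  have hB : 0 ≤ B := (norm_nonneg g).trans hg
  calc inner ℝ g (y - x) = inner ℝ g (y + s • (c - y) - x) + inner ℝ g (s • (y - c)) := by
        rw [← inner_add_right]
        congr 1
        module
    _ ≤ inner ℝ g (y + s • (c - y) - x) + ‖g‖ * (s * ‖y - c‖) := by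
        rw [← norm_smul_of_nonneg hs]
        gcongr
        exact real_inner_le_norm _ _
    _ ≤ inner ℝ g (y + s • (c - y) - x) + B * (s * D) := by gcongr

lemma sum_inner_le_of_soOGAStep {d : ℕ} {K : Set (EuclideanSpace ℝ (Fin d))}
    {c : EuclideanSpace ℝ (Fin d)} {SO : EuclideanSpace ℝ (Fin d) → EuclideanSpace ℝ (Fin d)}
    {D δ η r : ℝ} (hK : Convex ℝ K) (hdist : ∀ x ∈ K, ∀ y ∈ K, ‖x - y‖ ≤ D)
    (hSO : IsSeparationOracle K SO) (hD : 0 < D) (hδ : 0 < δ) (hδr : δ ≤ r) (hc : HasMargin K r c)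
    (hη : 0 < η) {x g : ℕ → EuclideanSpace ℝ (Fin d)} {B : ℝ} {m n : ℕ}
    (hmn : m ≤ n) (hx : x m ∈ K) (hg : ∀ q ∈ Finset.Ico m n, ‖g q‖ ≤ B)
    (hstep : ∀ q ∈ Finset.Ico m n, x (q + 1) = soOGAStep K c D SO δ η (x q) (g q))
    {y : EuclideanSpace ℝ (Fin d)} (hy : y ∈ K) :
    ∑ q ∈ Finset.Ico m n, inner ℝ (g q) (y - x q) ≤
      D ^ 2 / (2 * η) + (n - m : ℕ) * (η * B ^ 2 / 2 + B * (δ / r * D)) := by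
  have hcK : c ∈ K := hc.mem (hδ.trans_le hδr)
  have hr : 0 ≤ r := hδ.le.trans hδr
  have hu : HasMargin K δ (y + (δ / r) • (c - y)) := hc.add_smul_sub hK hδ hδr hy
  have huK := hu.mem hδ
  have hshrunk := sum_inner_sub_le_of_norm_sub_le hη hmn (hdist _ hx _ huK) hg fun q hq => by
    rw [hstep q hq]
    exact norm_soIP_sub_le hSO hD hδ hcK (hdist _ huK _ hcK) hu _
  calc ∑ q ∈ Finset.Ico m n, inner ℝ (g q) (y - x q)
      ≤ ∑ q ∈ Finset.Ico m n,
          (inner ℝ (g q) (y + (δ / r) • (c - y) - x q) + B * (δ / r * D)) :=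
        Finset.sum_le_sum fun q hq =>
          inner_sub_le_inner_add_smul_sub (by positivity) (hg q hq) (hdist y hy c hcK)
    _ ≤ D ^ 2 / (2 * η) + (n - m : ℕ) * (η * B ^ 2 / 2 + B * (δ / r * D)) := by
        rw [Finset.sum_add_distrib, Finset.sum_const, Nat.card_Ico, nsmul_eq_mul]
        linarith

end OnlineGradientAscent

section Cube

variable {d : ℕ}

lemma convex_unitCube : Convex ℝ (unitCube d) := by
  intro x hx y hy a b ha hb hab i
  exact (convex_Icc (0 : ℝ) 1) (hx i) (hy i) ha hb hab

lemma isCompact_unitCube : IsCompact (unitCube d) := by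
  have h := (EuclideanSpace.equiv (Fin d) ℝ).toHomeomorph.isCompact_preimage.2
    (isCompact_Icc (a := (0 : Fin d → ℝ)) (b := 1))
  convert h using 1
  ext x
  simp [unitCube, Pi.le_def, forall_and]

lemma bqndEstimate_sub (z : ℝ) (x v w : EuclideanSpace ℝ (Fin d)) :
    bqndEstimate z x (v - w) = bqndEstimate z x v - bqndEstimate z x w := by
  ext i
  simp only [bqndEstimate, PiLp.sub_apply]
  ring

lemma inner_bqndEstimate_left (z : ℝ) (x v w : EuclideanSpace ℝ (Fin d)) :
    inner ℝ (bqndEstimate z x v) w = inner ℝ v (bqndEstimate z x w) := by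
  simp only [PiLp.inner_apply, bqndEstimate, RCLike.inner_apply, RCLike.conj_to_real]
  exact Finset.sum_congr rfl fun i _ => by ring

lemma exp_neg_mul_mem_Icc {z a : ℝ} (hz : 0 ≤ z) (ha : 0 ≤ a ∧ a ≤ 1) :
    Real.exp (-(z * a)) ∈ Set.Icc (Real.exp (-z)) 1 :=
  ⟨Real.exp_le_exp.2 (neg_le_neg (mul_le_of_le_one_right hz ha.2)),
    Real.exp_le_one_iff.2 (neg_nonpos.2 (mul_nonneg hz ha.1))⟩

lemma norm_bqndEstimate_le {z : ℝ} (hz : 0 ≤ z) {x : EuclideanSpace ℝ (Fin d)}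
    (hx : x ∈ unitCube d) (v : EuclideanSpace ℝ (Fin d)) : ‖bqndEstimate z x v‖ ≤ ‖v‖ := by
  rw [EuclideanSpace.norm_eq, EuclideanSpace.norm_eq]
  refine Real.sqrt_le_sqrt (Finset.sum_le_sum fun i _ => ?_)
  simp only [bqndEstimate, norm_mul]
  gcongr
  rw [Real.norm_of_nonneg (Real.exp_pos _).le]
  exact mul_le_of_le_one_right (norm_nonneg _) (exp_neg_mul_mem_Icc hz (hx i)).2

lemma expMap_nonneg {z : ℝ} (hz : 0 ≤ z) {x : EuclideanSpace ℝ (Fin d)} (hx : x ∈ unitCube d)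
    (i : Fin d) : 0 ≤ expMap z x i :=
  sub_nonneg.2 (exp_neg_mul_mem_Icc hz (hx i)).2

lemma expMap_mem_unitCube {z : ℝ} (hz : 0 ≤ z) {x : EuclideanSpace ℝ (Fin d)}
    (hx : x ∈ unitCube d) : expMap z x ∈ unitCube d :=
  fun i => ⟨expMap_nonneg hz hx i, sub_le_self _ (Real.exp_pos _).le⟩

lemma expMap_le {z : ℝ} (hz : z ≤ 1) {x : EuclideanSpace ℝ (Fin d)} (hx : x ∈ unitCube d)
    (i : Fin d) : expMap z x i ≤ x i := by
  have hexp := Real.add_one_le_exp (-(z * x i))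
  have hzx : z * x i ≤ x i := mul_le_of_le_one_left (hx i).1 hz
  simp only [expMap]
  linarith

lemma expMap_le_expMap {s z : ℝ} (hsz : s ≤ z) {x : EuclideanSpace ℝ (Fin d)}
    (hx : x ∈ unitCube d) (i : Fin d) : expMap s x i ≤ expMap z x i :=
  sub_le_sub_left (Real.exp_le_exp.2 (neg_le_neg (mul_le_mul_of_nonneg_right hsz (hx i).1))) _

lemma continuous_expMap :
    Continuous fun p : ℝ × EuclideanSpace ℝ (Fin d) => expMap p.1 p.2 := by
  unfold expMap
  fun_prop

lemma continuous_bqndEstimate :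
    Continuous fun p : ℝ × EuclideanSpace ℝ (Fin d) × EuclideanSpace ℝ (Fin d) =>
      bqndEstimate p.1 p.2.1 p.2.2 := by
  unfold bqndEstimate
  fun_prop

lemma hasDerivAt_expMap (z : ℝ) (x : EuclideanSpace ℝ (Fin d)) :
    HasDerivAt (fun z => expMap z x) (bqndEstimate z x x) z := by
  rw [hasDerivAt_iff_hasFDerivAt, ← hasFDerivWithinAt_univ, hasFDerivWithinAt_euclidean]
  intro i
  have h : HasDerivAt (fun z : ℝ => 1 - Real.exp (-(z * x i)))
      (-(Real.exp (-(z * x i)) * (-(1 * x i)))) z :=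
    ((((hasDerivAt_id z).mul_const (x i)).neg).exp).const_sub 1
  refine h.hasFDerivAt.hasFDerivWithinAt.congr_fderiv ?_
  ext
  simp [bqndEstimate, mul_comm]

/-- A measurable convex down-closed set `K ⊆ [0,1]^d` all of whose pairwise distances are at most
`D`. Measurability, instead of the closedness of `IsConstraintSet`, is what makes the infeasible
projection onto `K` measurable. -/
structure IsFeasibleSet (K : Set (EuclideanSpace ℝ (Fin d))) (D : ℝ) : Prop where
  measurableSet : MeasurableSet K
  convex : Convex ℝ K
  subset_cube : K ⊆ unitCube d
  down_closed : ∀ y ∈ K, ∀ x : EuclideanSpace ℝ (Fin d), (∀ i, 0 ≤ x i ∧ x i ≤ y i) → x ∈ K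
  dist_le : ∀ x ∈ K, ∀ y ∈ K, ‖x - y‖ ≤ D

lemma IsConstraintSet.isFeasibleSet {K : Set (EuclideanSpace ℝ (Fin d))} {D : ℝ}
    (hK : IsConstraintSet K D) : IsFeasibleSet K D where
  measurableSet := hK.isClosed.measurableSet
  convex := hK.convex
  subset_cube := hK.subset_cube
  down_closed := hK.down_closed
  dist_le := hK.dist_le

lemma IsFeasibleSet.expMap_mem {K : Set (EuclideanSpace ℝ (Fin d))} {D : ℝ}
    (hK : IsFeasibleSet K D) {z : ℝ} (hz : z ∈ Set.Icc (0 : ℝ) 1)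
    {x : EuclideanSpace ℝ (Fin d)} (hx : x ∈ K) : expMap z x ∈ K :=
  hK.down_closed x hx _ fun i =>
    ⟨expMap_nonneg hz.1 (hK.subset_cube hx) i, expMap_le hz.2 (hK.subset_cube hx) i⟩

end Cube

section CubeGrad

variable {d : ℕ} {f : EuclideanSpace ℝ (Fin d) → ℝ}

lemma hasFDerivWithinAt_cubeGrad (hf : DifferentiableOn ℝ f (unitCube d))
    {x : EuclideanSpace ℝ (Fin d)} (hx : x ∈ unitCube d) :
    HasFDerivWithinAt f (InnerProductSpace.toDual ℝ _ (cubeGrad f x)) (unitCube d) x :=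
  (hf x hx).hasGradientWithinAt.hasFDerivWithinAt

lemma hasDerivWithinAt_comp_of_mapsTo_unitCube (hf : DifferentiableOn ℝ f (unitCube d))
    {γ : ℝ → EuclideanSpace ℝ (Fin d)} {γ' : EuclideanSpace ℝ (Fin d)} {I : Set ℝ} {s : ℝ}
    (hγ : HasDerivWithinAt γ γ' I s) (hs : s ∈ I) (hI : Set.MapsTo γ I (unitCube d)) :
    HasDerivWithinAt (fun s => f (γ s)) (inner ℝ (cubeGrad f (γ s)) γ') I s := by
  simpa only [Function.comp_def, InnerProductSpace.toDual_apply_apply] using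
    (hasFDerivWithinAt_cubeGrad hf (hI hs)).comp_hasDerivWithinAt s hγ hI

lemma exists_sub_eq_inner_cubeGrad (hf : DifferentiableOn ℝ f (unitCube d))
    {p w : EuclideanSpace ℝ (Fin d)} (hp : p ∈ unitCube d) (hpw : p + w ∈ unitCube d) :
    ∃ s ∈ Set.Ioo (0 : ℝ) 1, f (p + w) - f p = inner ℝ (cubeGrad f (p + s • w)) w := by
  have hseg : Set.MapsTo (fun s : ℝ => p + s • w) (Set.Icc 0 1) (unitCube d) := fun s hs =>
    convex_unitCube.add_smul_mem hp hpw hs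
  have hline (s : ℝ) : HasDerivAt (fun s : ℝ => p + s • w) w s := by
    simpa using ((hasDerivAt_id s).smul_const w).const_add p
  have hder : ∀ s ∈ Set.Icc (0 : ℝ) 1, HasDerivWithinAt (fun s : ℝ => f (p + s • w))
      (inner ℝ (cubeGrad f (p + s • w)) w) (Set.Icc 0 1) s := fun s hs =>
    hasDerivWithinAt_comp_of_mapsTo_unitCube hf (hline s).hasDerivWithinAt hs hseg
  obtain ⟨s, hs, heq⟩ := exists_hasDerivAt_eq_slope (fun s : ℝ => f (p + s • w))
    (fun s => inner ℝ (cubeGrad f (p + s • w)) w) zero_lt_one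
    (fun s hs => (hder s hs).continuousWithinAt)
    (fun s hs => (hder s (Set.Ioo_subset_Icc_self hs)).hasDerivAt (Icc_mem_nhds hs.1 hs.2))
  exact ⟨s, hs, by simpa using heq.symm⟩

lemma sub_le_mul_of_norm_cubeGrad_le (hf : DifferentiableOn ℝ f (unitCube d))
    {K : Set (EuclideanSpace ℝ (Fin d))} (hK : Convex ℝ K) (hKc : K ⊆ unitCube d) {M : ℝ}
    (hM : ∀ x ∈ K, ‖cubeGrad f x‖ ≤ M) {x y : EuclideanSpace ℝ (Fin d)} (hx : x ∈ K)
    (hy : y ∈ K) : f y - f x ≤ M * ‖y - x‖ := by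
  have hxy : x + (y - x) ∈ K := by simpa using hy
  obtain ⟨s, hs, heq⟩ := exists_sub_eq_inner_cubeGrad hf (hKc hx) (hKc hxy)
  calc f y - f x = inner ℝ (cubeGrad f (x + s • (y - x))) (y - x) := by
        rw [← heq, add_sub_cancel]
    _ ≤ ‖cubeGrad f (x + s • (y - x))‖ * ‖y - x‖ := real_inner_le_norm _ _
    _ ≤ M * ‖y - x‖ := by
        gcongr
        exact hM _ (hK.add_smul_mem hx hxy (Set.Ioo_subset_Icc_self hs))

lemma measurable_indicator_inner_cubeGrad (hf : DifferentiableOn ℝ f (unitCube d))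
    {v : EuclideanSpace ℝ (Fin d)} (hv : v ∈ unitCube d) :
    Measurable ((unitCube d).indicator fun x => inner ℝ (cubeGrad f x) (v - x)) := by
  have hcube : MeasurableSet (unitCube d) := isCompact_unitCube.measurableSet
  have hF : Measurable ((unitCube d).indicator f) := by
    classical
    rw [← Set.piecewise_eq_indicator]
    exact hf.continuousOn.measurable_piecewise continuousOn_const hcube
  let F := (unitCube d).indicator f
  let h : ℕ → ℝ := fun n => 1 / ((n : ℝ) + 1)
  let quotient : ℕ → EuclideanSpace ℝ (Fin d) → ℝ := fun n x =>
    ((n : ℝ) + 1) * (F (x + h n • (v - x)) - F x)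
  have hquotient (n : ℕ) : Measurable (quotient n) :=
    ((hF.comp (by fun_prop)).sub hF).const_mul _
  refine measurable_of_tendsto_metrizable (fun n => (hquotient n).indicator hcube)
    (tendsto_pi_nhds.2 fun x => ?_)
  by_cases hx : x ∈ unitCube d
  swap
  · simp [hx]
  have hseg (n : ℕ) : x + h n • (v - x) ∈ unitCube d :=
    convex_unitCube.add_smul_sub_mem hx hv
      ⟨by positivity, by simpa [h] using Nat.one_div_le_one_div (α := ℝ) n.zero_le⟩
  have hh : Filter.Tendsto (fun n => h n • (v - x)) Filter.atTop (nhds 0) := by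
    simpa only [zero_smul] using
      (tendsto_one_div_add_atTop_nhds_zero_nat (𝕜 := ℝ)).smul_const (v - x)
  have hlim := (hasFDerivWithinAt_cubeGrad hf hx).lim (c := fun n : ℕ => (n : ℝ) + 1) hh
    (.of_forall hseg) (v := v - x) <| tendsto_const_nhds.congr fun n => by
      rw [smul_smul, mul_one_div_cancel n.cast_add_one_ne_zero, one_smul]
  simpa only [Set.indicator_of_mem hx, Set.indicator_of_mem (hseg _), quotient, F,
    InnerProductSpace.toDual_apply_apply, smul_eq_mul] using hlim

lemma cubeGrad_of_notMem {x : EuclideanSpace ℝ (Fin d)} (hx : x ∉ unitCube d) :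
    cubeGrad f x = 0 := by
  rw [cubeGrad, gradientWithin, fderivWithin_zero_of_notMem_closure, map_zero]
  rwa [isCompact_unitCube.isClosed.closure_eq]

lemma measurable_cubeGrad (hf : DifferentiableOn ℝ f (unitCube d)) : Measurable (cubeGrad f) := by
  have hvertex (i : Fin d) : EuclideanSpace.single i (1 : ℝ) ∈ unitCube d := fun j => by
    rw [PiLp.single_apply]
    split_ifs <;> norm_num
  have hcoord (i : Fin d) : Measurable fun x => cubeGrad f x i := by
    have hdiff := (measurable_indicator_inner_cubeGrad hf (hvertex i)).sub
      (measurable_indicator_inner_cubeGrad hf (v := 0) fun j => by simp)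
    convert hdiff using 2 with x
    by_cases hx : x ∈ unitCube d
    · simp [hx, inner_sub_right, EuclideanSpace.inner_single_right]
    · simp [hx, cubeGrad_of_notMem]
  exact (WithLp.measurable_toLp 2 _).comp (measurable_pi_iff.2 hcoord)

end CubeGrad

section DRSubmodular

variable {d : ℕ} {f : EuclideanSpace ℝ (Fin d) → ℝ}

/-- Differentiable DR-submodular functions on the cube: the gradient is antitone for the
coordinatewise order. -/
structure IsDRSubmodular (f : EuclideanSpace ℝ (Fin d) → ℝ) : Prop where
  differentiableOn : DifferentiableOn ℝ f (unitCube d)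
  cubeGrad_antitone : ∀ x ∈ unitCube d, ∀ y ∈ unitCube d, (∀ i, x i ≤ y i) →
    ∀ i, cubeGrad f y i ≤ cubeGrad f x i

namespace IsDRSubmodular

lemma inner_cubeGrad_antitone (hf : IsDRSubmodular f) {x y w : EuclideanSpace ℝ (Fin d)}
    (hx : x ∈ unitCube d) (hy : y ∈ unitCube d) (hxy : ∀ i, x i ≤ y i) (hw : ∀ i, 0 ≤ w i) :
    inner ℝ (cubeGrad f y) w ≤ inner ℝ (cubeGrad f x) w := by
  simp only [PiLp.inner_apply, RCLike.inner_apply, RCLike.conj_to_real]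
  exact Finset.sum_le_sum fun i _ =>
    mul_le_mul_of_nonneg_left (hf.cubeGrad_antitone x hx y hy hxy i) (hw i)

lemma sub_le_inner (hf : IsDRSubmodular f) {p w : EuclideanSpace ℝ (Fin d)}
    (hp : p ∈ unitCube d) (hpw : p + w ∈ unitCube d) (hw : ∀ i, 0 ≤ w i) :
    f (p + w) - f p ≤ inner ℝ (cubeGrad f p) w := by
  obtain ⟨s, hs, heq⟩ := exists_sub_eq_inner_cubeGrad hf.differentiableOn hp hpw
  rw [heq]
  exact hf.inner_cubeGrad_antitone hp
    (convex_unitCube.add_smul_mem hp hpw (Set.Ioo_subset_Icc_self hs))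
    (fun i => le_add_of_nonneg_right (mul_nonneg hs.1.le (hw i))) hw

lemma inner_le_sub (hf : IsDRSubmodular f) {p w : EuclideanSpace ℝ (Fin d)}
    (hp : p ∈ unitCube d) (hpw : p + w ∈ unitCube d) (hw : ∀ i, 0 ≤ w i) :
    inner ℝ (cubeGrad f (p + w)) w ≤ f (p + w) - f p := by
  obtain ⟨s, hs, heq⟩ := exists_sub_eq_inner_cubeGrad hf.differentiableOn hp hpw
  rw [heq]
  exact hf.inner_cubeGrad_antitone
    (convex_unitCube.add_smul_mem hp hpw (Set.Ioo_subset_Icc_self hs)) hpw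
    (fun i => add_le_add_right (mul_le_of_le_one_left (hw i) hs.2.le) _) hw

lemma concave_of_nonneg (hf : IsDRSubmodular f) {p w : EuclideanSpace ℝ (Fin d)} {θ : ℝ}
    (hθ : θ ∈ Set.Icc (0 : ℝ) 1) (hp : p ∈ unitCube d) (hpw : p + w ∈ unitCube d)
    (hw : ∀ i, 0 ≤ w i) : (1 - θ) * f p + θ * f (p + w) ≤ f (p + θ • w) := by
  have hmid : p + θ • w ∈ unitCube d := convex_unitCube.add_smul_mem hp hpw hθ
  have hsplit : p + θ • w + (1 - θ) • w = p + w := by module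
  have hlow := hf.inner_le_sub hp hmid fun i => mul_nonneg hθ.1 (hw i)
  have hhigh := hf.sub_le_inner hmid (hsplit ▸ hpw) fun i =>
    mul_nonneg (sub_nonneg.2 hθ.2) (hw i)
  rw [hsplit, inner_smul_right] at hhigh
  rw [inner_smul_right] at hlow
  linarith [mul_le_mul_of_nonneg_left hlow (sub_nonneg.2 hθ.2),
    mul_le_mul_of_nonneg_left hhigh hθ.1]

-- Extend the move from `y` by the factor `1 / θ`: the end point is still in the cube, `f` is
-- non-negative there, and `f` is concave along the segment.
lemma one_sub_mul_le (hf : IsDRSubmodular f) (hf0 : ∀ x ∈ unitCube d, 0 ≤ f x)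
    {y u : EuclideanSpace ℝ (Fin d)} {θ : ℝ} (hθ : θ ∈ Set.Icc (0 : ℝ) 1) (hy : y ∈ unitCube d)
    (hu0 : ∀ i, 0 ≤ u i) (hu : ∀ i, u i ≤ θ * (1 - y i)) : (1 - θ) * f y ≤ f (y + u) := by
  rcases hθ.1.eq_or_lt with rfl | hpos
  · have hu_zero : u = 0 := by
      ext i
      exact le_antisymm (by simpa using hu i) (hu0 i)
    simp [hu_zero]
  have hend : y + θ⁻¹ • u ∈ unitCube d := fun i => by
    have hle : θ⁻¹ * u i ≤ 1 - y i := (inv_mul_le_iff₀ hpos).2 (hu i)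
    have hnonneg : 0 ≤ θ⁻¹ * u i := mul_nonneg (inv_nonneg.2 hθ.1) (hu0 i)
    simp only [PiLp.add_apply, PiLp.smul_apply, smul_eq_mul]
    exact ⟨add_nonneg (hy i).1 hnonneg, by linarith⟩
  have hconc := hf.concave_of_nonneg hθ hy hend fun i =>
    mul_nonneg (inv_nonneg.2 hθ.1) (hu0 i)
  rw [smul_inv_smul₀ hpos.ne'] at hconc
  linarith [mul_nonneg hθ.1 (hf0 _ hend)]

lemma exp_neg_mul_sub_le_inner_bqndEstimate (hf : IsDRSubmodular f)
    (hf0 : ∀ x ∈ unitCube d, 0 ≤ f x) {x y : EuclideanSpace ℝ (Fin d)} (hx : x ∈ unitCube d)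
    (hy : y ∈ unitCube d) {z : ℝ} (hz : 0 ≤ z) :
    Real.exp (-z) * f y - f (expMap z x) ≤
      inner ℝ (cubeGrad f (expMap z x)) (bqndEstimate z x y) := by
  have hexp (i : Fin d) := exp_neg_mul_mem_Icc hz (hx i)
  have hz1 : Real.exp (-z) ≤ 1 := Real.exp_le_one_iff.2 (neg_nonpos.2 hz)
  let u : EuclideanSpace ℝ (Fin d) := WithLp.toLp 2 fun i => expMap z x i * (1 - y i)
  have hsum : expMap z x + bqndEstimate z x y = y + u := by
    ext i
    simp only [expMap, bqndEstimate, u, PiLp.add_apply]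
    ring
  have hu0 (i : Fin d) : 0 ≤ u i := mul_nonneg (expMap_nonneg hz hx i) (sub_nonneg.2 (hy i).2)
  have hu (i : Fin d) : u i ≤ (1 - Real.exp (-z)) * (1 - y i) :=
    mul_le_mul_of_nonneg_right (sub_le_sub_left (hexp i).1 1) (sub_nonneg.2 (hy i).2)
  have hmem : y + u ∈ unitCube d := fun i => by
    have hle : u i ≤ 1 * (1 - y i) := (hu i).trans <| mul_le_mul_of_nonneg_right
      (sub_le_self _ (Real.exp_pos _).le) (sub_nonneg.2 (hy i).2)
    exact ⟨add_nonneg (hy i).1 (hu0 i), by simpa using by linarith⟩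
  have hvalue := hf.one_sub_mul_le hf0
    ⟨sub_nonneg.2 hz1, sub_le_self _ (Real.exp_pos _).le⟩ hy hu0 hu
  have hgrad := hf.sub_le_inner (expMap_mem_unitCube hz hx) (hsum ▸ hmem) fun i =>
    mul_nonneg (hy i).1 (Real.exp_pos _).le
  rw [hsum] at hgrad
  rw [sub_sub_cancel] at hvalue
  linarith

lemma exp_neg_one_mul_sub_le_exp_sub_one_mul (hf : IsDRSubmodular f)
    (hf0 : ∀ x ∈ unitCube d, 0 ≤ f x) {x y : EuclideanSpace ℝ (Fin d)} (hx : x ∈ unitCube d)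
    (hy : y ∈ unitCube d) {z : ℝ} (hz : 0 ≤ z) :
    Real.exp (-1) * f y - Real.exp (z - 1) *
        (f (expMap z x) + inner ℝ (cubeGrad f (expMap z x)) (bqndEstimate z x x)) ≤
      Real.exp (z - 1) * inner ℝ (cubeGrad f (expMap z x)) (bqndEstimate z x (y - x)) := by
  have hexp : Real.exp (z - 1) * Real.exp (-z) = Real.exp (-1) := by
    rw [← Real.exp_add]
    ring_nf
  rw [← hexp, mul_assoc, ← mul_sub, bqndEstimate_sub, inner_sub_right]
  refine mul_le_mul_of_nonneg_left ?_ (Real.exp_pos _).le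
  linarith [hf.exp_neg_mul_sub_le_inner_bqndEstimate hf0 hx hy hz]

lemma intervalIntegrable_inner_cubeGrad_expMap (hf : IsDRSubmodular f)
    {x : EuclideanSpace ℝ (Fin d)} (hx : x ∈ unitCube d) (w : EuclideanSpace ℝ (Fin d)) :
    IntervalIntegrable
      (fun z => inner ℝ (cubeGrad f (expMap z x)) (bqndEstimate z x w)) volume 0 1 := by
  have hantitone (i : Fin d) :
      AntitoneOn (fun z => cubeGrad f (expMap z x) i) (Set.uIcc 0 1) := by
    rw [Set.uIcc_of_le zero_le_one]
    exact fun s hs z hz hsz => hf.cubeGrad_antitone _ (expMap_mem_unitCube hs.1 hx) _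
      (expMap_mem_unitCube hz.1 hx) (expMap_le_expMap hsz hx) i
  have hcont (i : Fin d) : Continuous fun z => bqndEstimate z x w i := by
    unfold bqndEstimate
    fun_prop
  simpa only [PiLp.inner_apply, RCLike.inner_apply, RCLike.conj_to_real, Finset.sum_fn] using
    IntervalIntegrable.sum Finset.univ fun i _ =>
      (hantitone i).intervalIntegrable.continuousOn_mul (hcont i).continuousOn

end IsDRSubmodular

lemma integral_exp_sub_one_mul {φ φ' : ℝ → ℝ} (hφ : ContinuousOn φ (Set.Icc 0 1))
    (hderiv : ∀ z ∈ Set.Ioo (0 : ℝ) 1, HasDerivAt φ (φ' z) z)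
    (hφ' : IntervalIntegrable φ' volume 0 1) :
    IntervalIntegrable (fun z => Real.exp (z - 1) * (φ z + φ' z)) volume 0 1 ∧
      ∫ z in (0 : ℝ)..1, Real.exp (z - 1) * (φ z + φ' z) = φ 1 - Real.exp (-1) * φ 0 := by
  have hexp : Continuous fun z : ℝ => Real.exp (z - 1) := by fun_prop
  have hint : IntervalIntegrable (fun z => Real.exp (z - 1) * (φ z + φ' z)) volume 0 1 :=
    ((hφ.intervalIntegrable_of_Icc zero_le_one).add hφ').continuousOn_mul hexp.continuousOn
  refine ⟨hint, ?_⟩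
  rw [intervalIntegral.integral_eq_sub_of_hasDerivAt_of_le zero_le_one
    (f := fun z => Real.exp (z - 1) * φ z) (hexp.continuousOn.mul hφ) (fun z hz => ?_) hint]
  · simp
  · have hz' : HasDerivAt (fun z : ℝ => Real.exp (z - 1)) (Real.exp (z - 1)) z := by
      simpa using ((hasDerivAt_id z).sub_const 1).exp
    rw [mul_add]
    exact hz'.mul (hderiv z hz)

lemma one_sub_exp_neg_one_pos : 0 < 1 - Real.exp (-1) := by
  rw [sub_pos, Real.exp_lt_one_iff]
  norm_num

lemma integral_bqndLaw (φ : ℝ → ℝ) :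
    ∫ z, φ z ∂bqndLaw =
      (1 - Real.exp (-1))⁻¹ * ∫ z in (0 : ℝ)..1, Real.exp (z - 1) * φ z := by
  rw [bqndLaw, integral_withDensity_eq_integral_toReal_smul (by fun_prop) (by simp),
    intervalIntegral.integral_of_le zero_le_one, ← integral_Icc_eq_integral_Ioc,
    ← integral_const_mul]
  refine integral_congr_ae (ae_of_all _ fun z => ?_)
  have hpos := one_sub_exp_neg_one_pos
  simp only [smul_eq_mul]
  rw [ENNReal.toReal_ofReal (by positivity)]
  ring

lemma ae_bqndLaw_mem : ∀ᵐ z ∂bqndLaw, z ∈ Set.Icc (0 : ℝ) 1 :=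
  (withDensity_absolutelyContinuous _ _).ae_le (ae_restrict_mem measurableSet_Icc)

-- With `φ z = f (expMap z x)`, the density `e^(z-1)` makes `e^(z-1) (φ z + φ' z)` an exact
-- derivative, which turns the pointwise bound into a bound by the end point `φ 1`.
lemma IsDRSubmodular.exp_neg_one_mul_sub_le_integral_inner (hf : IsDRSubmodular f)
    (hf0 : ∀ x ∈ unitCube d, 0 ≤ f x) {x y : EuclideanSpace ℝ (Fin d)} (hx : x ∈ unitCube d)
    (hy : y ∈ unitCube d) :
    Real.exp (-1) * f y - f (expMap 1 x) ≤ (1 - Real.exp (-1)) *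
      ∫ z, inner ℝ (cubeGrad f (expMap z x)) (bqndEstimate z x (y - x)) ∂bqndLaw := by
  rw [integral_bqndLaw, mul_inv_cancel_left₀ one_sub_exp_neg_one_pos.ne']
  let φ : ℝ → ℝ := fun z => f (expMap z x)
  let φ' : ℝ → ℝ := fun z => inner ℝ (cubeGrad f (expMap z x)) (bqndEstimate z x x)
  have hmaps : Set.MapsTo (fun z => expMap z x) (Set.Icc 0 1) (unitCube d) :=
    fun z hz => expMap_mem_unitCube hz.1 hx
  have hderiv : ∀ z ∈ Set.Icc (0 : ℝ) 1, HasDerivWithinAt φ (φ' z) (Set.Icc 0 1) z := fun z hz =>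
    hasDerivWithinAt_comp_of_mapsTo_unitCube hf.differentiableOn
      (hasDerivAt_expMap z x).hasDerivWithinAt hz hmaps
  obtain ⟨hint, hftc⟩ := integral_exp_sub_one_mul
    (fun z hz => (hderiv z hz).continuousWithinAt)
    (fun z hz => (hderiv z (Set.Ioo_subset_Icc_self hz)).hasDerivAt (Icc_mem_nhds hz.1 hz.2))
    (hf.intervalIntegrable_inner_cubeGrad_expMap hx x)
  have hmono := intervalIntegral.integral_mono_on zero_le_one (intervalIntegrable_const.sub hint)
    ((hf.intervalIntegrable_inner_cubeGrad_expMap hx (y - x)).continuousOn_mul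
      (by fun_prop)) fun z hz => hf.exp_neg_one_mul_sub_le_exp_sub_one_mul hf0 hx hy hz.1
  rw [intervalIntegral.integral_sub intervalIntegrable_const hint, hftc,
    intervalIntegral.integral_const, sub_zero, one_smul] at hmono
  have hstart : 0 ≤ Real.exp (-1) * φ 0 :=
    mul_nonneg (Real.exp_pos _).le (hf0 _ (hmaps ⟨le_rfl, zero_le_one⟩))
  linarith

end DRSubmodular

section Independence

variable {Ω : Type*} {mΩ : MeasurableSpace Ω} {P : Measure Ω}

lemma integrable_comp_of_continuousOn_of_isCompact [IsFiniteMeasure P] {E F : Type*}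
    [TopologicalSpace E] [T2Space E] [MeasurableSpace E] [OpensMeasurableSpace E]
    [NormedAddCommGroup F] {K : Set E} (hK : IsCompact K) {f : E → F} (hf : ContinuousOn f K)
    {X : Ω → E} (hX : AEMeasurable X P) (hXK : ∀ᵐ ω ∂P, X ω ∈ K) :
    Integrable (fun ω => f (X ω)) P := by
  have h := hf.integrableOn_compact (μ := P.map X) hK
  rw [IntegrableOn, Measure.restrict_eq_self_of_ae_mem
    ((ae_map_iff hX hK.measurableSet).2 hXK)] at h
  exact h.comp_aemeasurable hX

lemma integrable_inner_of_norm_le [IsFiniteMeasure P] {E : Type*} [NormedAddCommGroup E]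
    [InnerProductSpace ℝ E] {u w : Ω → E} {A B : ℝ} (hu : AEStronglyMeasurable u P)
    (hw : AEStronglyMeasurable w P) (huA : ∀ᵐ ω ∂P, ‖u ω‖ ≤ A) (hwB : ∀ᵐ ω ∂P, ‖w ω‖ ≤ B) :
    Integrable (fun ω => inner ℝ (u ω) (w ω)) P := by
  refine .of_bound (hu.inner hw) (A * B) ?_
  filter_upwards [huA, hwB] with ω h₁ h₂
  exact (norm_inner_le_norm _ _).trans
    (mul_le_mul h₁ h₂ (norm_nonneg _) ((norm_nonneg _).trans h₁))

section Pair

variable [IsFiniteMeasure P] {α β E : Type*} [MeasurableSpace α] [MeasurableSpace β]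
  [NormedAddCommGroup E] {X : Ω → α} {Y : Ω → β} {g : α × β → E}

lemma integrable_map_prod_map_of_indepFun (hX : AEMeasurable X P) (hY : AEMeasurable Y P)
    (h : IndepFun X Y P) (hg : StronglyMeasurable g)
    (hgi : Integrable (fun ω => g (X ω, Y ω)) P) :
    Integrable g ((P.map X).prod (P.map Y)) := by
  rw [← h.map_prod_eq_prod_map_map hX hY]
  exact (integrable_map_measure hg.aestronglyMeasurable (hX.prodMk hY)).2 hgi

variable [NormedSpace ℝ E]

lemma integrable_integral_of_indepFun (hX : AEMeasurable X P) (hY : AEMeasurable Y P)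
    (h : IndepFun X Y P) (hg : StronglyMeasurable g)
    (hgi : Integrable (fun ω => g (X ω, Y ω)) P) :
    Integrable (fun ω => ∫ b, g (X ω, b) ∂(P.map Y)) P :=
  (integrable_map_prod_map_of_indepFun hX hY h hg hgi).integral_prod_left.comp_aemeasurable hX

lemma integral_eq_integral_integral_of_indepFun (hX : AEMeasurable X P) (hY : AEMeasurable Y P)
    (h : IndepFun X Y P) (hg : StronglyMeasurable g)
    (hgi : Integrable (fun ω => g (X ω, Y ω)) P) :
    ∫ ω, g (X ω, Y ω) ∂P = ∫ ω, ∫ b, g (X ω, b) ∂(P.map Y) ∂P := by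
  have hprod := integrable_map_prod_map_of_indepFun hX hY h hg hgi
  rw [← integral_map (f := g) (hX.prodMk hY) hg.aestronglyMeasurable,
    h.map_prod_eq_prod_map_map hX hY, integral_prod _ hprod,
    integral_map hX hprod.integral_prod_left.aestronglyMeasurable]

end Pair

lemma setIntegral_eq_measureReal_smul_integral_of_indep [IsFiniteMeasure P] {E : Type*}
    [NormedAddCommGroup E] [NormedSpace ℝ E] [CompleteSpace E] {m₁ m₂ : MeasurableSpace Ω}
    (hm₁ : m₁ ≤ mΩ) (hm₂ : m₂ ≤ mΩ) (h : Indep m₁ m₂ P) {φ : Ω → E}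
    (hφ : StronglyMeasurable[m₁] φ) (hφi : Integrable φ P) {A : Set Ω}
    (hA : MeasurableSet[m₂] A) :
    ∫ ω in A, φ ω ∂P = P.real A • ∫ ω, φ ω ∂P := by
  rw [← setIntegral_condExp hm₂ hφi hA,
    setIntegral_congr_ae (hm₂ _ hA) ((condExp_indep_eq hm₁ hm₂ hφ h).mono fun _ hω _ => hω),
    setIntegral_const]

lemma setIntegral_inner_eq_setIntegral_inner_condExp [IsFiniteMeasure P] {E : Type*}
    [NormedAddCommGroup E] [InnerProductSpace ℝ E] [CompleteSpace E] {m : MeasurableSpace Ω}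
    (hm : m ≤ mΩ) {u w : Ω → E} (hu : Integrable u P) (hw : StronglyMeasurable[m] w)
    (huw : Integrable (fun ω => inner ℝ (u ω) (w ω)) P) {A : Set Ω} (hA : MeasurableSet[m] A) :
    ∫ ω in A, inner ℝ (u ω) (w ω) ∂P = ∫ ω in A, inner ℝ ((P[u | m]) ω) (w ω) ∂P := by
  rw [← setIntegral_condExp hm huw hA]
  exact setIntegral_congr_ae (hm _ hA)
    ((condExp_bilin_of_stronglyMeasurable_right (innerSL ℝ) hw huw hu).mono fun _ hω _ => hω)

lemma setIntegral_inner_eq_measureReal_mul_integral_inner [IsFiniteMeasure P] {E : Type*}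
    [NormedAddCommGroup E] [InnerProductSpace ℝ E] [CompleteSpace E]
    {m m₁ m₂ : MeasurableSpace Ω} (hm : m ≤ mΩ) (hm₁ : m₁ ≤ m) (hm₂ : m₂ ≤ m)
    (hind : Indep m₂ m₁ P) {u v w : Ω → E} (hu : Integrable u P)
    (hv : StronglyMeasurable[m₁] v) (hw : StronglyMeasurable[m₁] w)
    (huw : Integrable (fun ω => inner ℝ (u ω) (w ω)) P)
    (hvw : Integrable (fun ω => inner ℝ (v ω) (w ω)) P) {A : Set Ω} (hA : MeasurableSet[m₂] A)
    (huv : ∀ᵐ ω ∂P, ω ∈ A → (P[u | m]) ω = v ω) :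
    ∫ ω in A, inner ℝ (u ω) (w ω) ∂P = P.real A * ∫ ω, inner ℝ (v ω) (w ω) ∂P :=
  calc ∫ ω in A, inner ℝ (u ω) (w ω) ∂P
      = ∫ ω in A, inner ℝ ((P[u | m]) ω) (w ω) ∂P :=
        setIntegral_inner_eq_setIntegral_inner_condExp hm hu (hw.mono hm₁) huw (hm₂ _ hA)
    _ = ∫ ω in A, inner ℝ (v ω) (w ω) ∂P :=
        setIntegral_congr_ae (hm _ (hm₂ _ hA))
          (huv.mono fun ω hω hωA => congrArg (inner ℝ · (w ω)) (hω hωA))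
    _ = P.real A * ∫ ω, inner ℝ (v ω) (w ω) ∂P :=
        setIntegral_eq_measureReal_smul_integral_of_indep (hm₁.trans hm) (hm₂.trans hm)
          hind.symm (hv.inner hw) hvw hA

end Independence

section Permutation

lemma card_mul_card_filter_perm_apply_eq {α : Type*} [Fintype α] [DecidableEq α] (a b : α) :
    Fintype.card α * (Finset.univ.filter fun σ : Equiv.Perm α => σ a = b).card =
      (Fintype.card α).factorial := by
  have hfiber (b' : α) : (Finset.univ.filter fun σ : Equiv.Perm α => σ a = b').card =
      (Finset.univ.filter fun σ : Equiv.Perm α => σ a = b).card := by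
    refine Finset.card_equiv (Equiv.mulLeft (Equiv.swap b' b)) fun σ => ?_
    simp [Equiv.swap_apply_eq_iff]
  have hsum := Finset.card_eq_sum_card_fiberwise (f := fun σ : Equiv.Perm α => σ a)
    (s := Finset.univ) (t := Finset.univ) (by simp [Set.MapsTo])
  rw [Finset.sum_congr rfl fun b' _ => hfiber b'] at hsum
  simpa [Fintype.card_perm] using hsum.symm

lemma comap_top_le_of_measurableSet_eq {Ω α : Type*} [Countable α] {mΩ : MeasurableSpace Ω}
    {σ : Ω → α} (h : ∀ a, MeasurableSet {ω | σ ω = a}) : MeasurableSpace.comap σ ⊤ ≤ mΩ :=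
  letI : MeasurableSpace α := ⊤
  (measurable_to_countable' h).comap_le

lemma measureReal_perm_apply_eq {Ω : Type*} {mΩ : MeasurableSpace Ω} {P : Measure Ω}
    {α : Type*} [Fintype α] {σ : Ω → Equiv.Perm α}
    (hm : ∀ p, MeasurableSet {ω | σ ω = p})
    (hlaw : ∀ p, P {ω | σ ω = p} = ((Fintype.card α).factorial : ENNReal)⁻¹) (a b : α) :
    P.real {ω | σ ω a = b} = (Fintype.card α : ℝ)⁻¹ := by
  classical
  let S := Finset.univ.filter fun τ : Equiv.Perm α => τ a = b
  have hset : {ω | σ ω a = b} = ⋃ τ ∈ S, {ω | σ ω = τ} := by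
    ext ω
    simp [S]
  have hmeas : P {ω | σ ω a = b} = S.card * ((Fintype.card α).factorial : ENNReal)⁻¹ := by
    rw [hset, measure_biUnion_finset (fun τ _ τ' _ hne => Set.disjoint_left.2
      fun ω h h' => hne (h.symm.trans h')) fun τ _ => hm τ]
    simp [hlaw]
  have hcard : (Fintype.card α * S.card : ℝ) = (Fintype.card α).factorial := by
    exact_mod_cast card_mul_card_filter_perm_apply_eq a b
  have hfact : ((Fintype.card α).factorial : ℝ) ≠ 0 := by positivity
  rw [measureReal_def, hmeas, ENNReal.toReal_mul, ENNReal.toReal_inv, ENNReal.toReal_natCast,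
    ENNReal.toReal_natCast, ← div_eq_mul_inv, div_eq_iff hfact, ← hcard,
    inv_mul_cancel_left₀ fun h => hfact (by rw [← hcard, h, zero_mul])]

end Permutation

section OneQuery

variable {d : ℕ}

/-- Non-negative differentiable DR-submodular functions on the cube that are `M₁`-Lipschitz on
`K`: the rewards for which the regret bounds are proved. -/
structure IsDRObjective (K : Set (EuclideanSpace ℝ (Fin d))) (M₁ : ℝ)
    (f : EuclideanSpace ℝ (Fin d) → ℝ) : Prop extends IsDRSubmodular f where
  nonneg : ∀ x ∈ unitCube d, 0 ≤ f x
  norm_cubeGrad_le : ∀ x ∈ K, ‖cubeGrad f x‖ ≤ M₁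

variable {K : Set (EuclideanSpace ℝ (Fin d))} {D M₁ : ℝ} {f : EuclideanSpace ℝ (Fin d) → ℝ}

lemma IsObjective.isDRObjective {Λ : ℝ} (hf : IsObjective K M₁ Λ f) : IsDRObjective K M₁ f where
  differentiableOn := hf.differentiable
  cubeGrad_antitone := hf.dr_submodular
  nonneg := hf.nonneg
  norm_cubeGrad_le := hf.lipschitz

lemma IsFeasibleSet.norm_bqndEstimate_sub_le (hK : IsFeasibleSet K D) {z : ℝ} (hz : 0 ≤ z)
    {x y : EuclideanSpace ℝ (Fin d)} (hx : x ∈ K) (hy : y ∈ K) :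
    ‖bqndEstimate z x (y - x)‖ ≤ D :=
  (norm_bqndEstimate_le hz (hK.subset_cube hx) _).trans (hK.dist_le y hy x hx)

namespace IsDRObjective

lemma sub_le (hf : IsDRObjective K M₁ f) (hK : IsFeasibleSet K D)
    {x y : EuclideanSpace ℝ (Fin d)} (hx : x ∈ K) (hy : y ∈ K) : f y - f x ≤ M₁ * D :=
  (sub_le_mul_of_norm_cubeGrad_le hf.differentiableOn hK.convex hK.subset_cube
    hf.norm_cubeGrad_le hx hy).trans <|
    mul_le_mul_of_nonneg_left (hK.dist_le y hy x hx)
      ((norm_nonneg _).trans (hf.norm_cubeGrad_le x hx))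

variable {Ω : Type*} {mΩ : MeasurableSpace Ω} {P : Measure Ω}
  {x : Ω → EuclideanSpace ℝ (Fin d)} {y : EuclideanSpace ℝ (Fin d)} {Z : Ω → ℝ}

lemma integrable_comp [IsFiniteMeasure P] (hf : IsDRObjective K M₁ f) (hK : IsFeasibleSet K D)
    (hx : Measurable x) (hxK : ∀ᵐ ω ∂P, x ω ∈ K) : Integrable (fun ω => f (x ω)) P :=
  integrable_comp_of_continuousOn_of_isCompact isCompact_unitCube hf.differentiableOn.continuousOn
    hx.aemeasurable (hxK.mono fun _ hω => hK.subset_cube hω)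

lemma integrable_inner_cubeGrad_expMap [IsFiniteMeasure P] (hf : IsDRObjective K M₁ f)
    (hK : IsFeasibleSet K D) (hx : Measurable x) (hxK : ∀ ω, x ω ∈ K) (hZ : Measurable Z)
    (hZI : ∀ᵐ ω ∂P, Z ω ∈ Set.Icc (0 : ℝ) 1) (hy : y ∈ K) :
    Integrable (fun ω => inner ℝ (cubeGrad f (expMap (Z ω) (x ω)))
      (bqndEstimate (Z ω) (x ω) (y - x ω))) P :=
  integrable_inner_of_norm_le
    ((measurable_cubeGrad hf.differentiableOn).comp
      (continuous_expMap.measurable.comp (hZ.prodMk hx))).aestronglyMeasurable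
    (continuous_bqndEstimate.measurable.comp
      (hZ.prodMk (hx.prodMk (hx.const_sub y)))).aestronglyMeasurable
    (hZI.mono fun ω hω => hf.norm_cubeGrad_le _ (hK.expMap_mem hω (hxK ω)))
    (hZI.mono fun ω hω => hK.norm_bqndEstimate_sub_le hω.1 (hxK ω) hy)

lemma sub_integral_le_integral_inner [IsProbabilityMeasure P] (hf : IsDRObjective K M₁ f)
    (hK : IsFeasibleSet K D) (hx : Measurable x) (hxK : ∀ ω, x ω ∈ K) (hZ : Measurable Z)
    (hlaw : P.map Z = bqndLaw) (hind : IndepFun x Z P) (hy : y ∈ K) :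
    Real.exp (-1) * f y - ∫ ω, f (expMap 1 (x ω)) ∂P ≤
      (1 - Real.exp (-1)) * ∫ ω, inner ℝ (cubeGrad f (expMap (Z ω) (x ω)))
        (bqndEstimate (Z ω) (x ω) (y - x ω)) ∂P := by
  let ψ : EuclideanSpace ℝ (Fin d) × ℝ → ℝ := fun p =>
    inner ℝ (cubeGrad f (expMap p.2 p.1)) (bqndEstimate p.2 p.1 (y - p.1))
  have hψ : StronglyMeasurable ψ :=
    (((measurable_cubeGrad hf.differentiableOn).comp
      (continuous_expMap.comp continuous_swap).measurable).inner
      (continuous_bqndEstimate.comp (by fun_prop :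
        Continuous fun p : EuclideanSpace ℝ (Fin d) × ℝ =>
          (p.2, p.1, y - p.1))).measurable).stronglyMeasurable
  have hψi : Integrable (fun ω => ψ (x ω, Z ω)) P :=
    hf.integrable_inner_cubeGrad_expMap hK hx hxK hZ
      (ae_of_ae_map hZ.aemeasurable (by rw [hlaw]; exact ae_bqndLaw_mem)) hy
  have hfub := integral_eq_integral_integral_of_indepFun hx.aemeasurable hZ.aemeasurable hind hψ hψi
  have hint := integrable_integral_of_indepFun hx.aemeasurable hZ.aemeasurable hind hψ hψi
  rw [hlaw] at hfub hint
  have haction : Integrable (fun ω => f (expMap 1 (x ω))) P :=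
    hf.integrable_comp hK (continuous_expMap.measurable.comp (measurable_const.prodMk hx))
      (ae_of_all _ fun ω => hK.expMap_mem ⟨zero_le_one, le_rfl⟩ (hxK ω))
  calc Real.exp (-1) * f y - ∫ ω, f (expMap 1 (x ω)) ∂P
      = ∫ ω, (Real.exp (-1) * f y - f (expMap 1 (x ω))) ∂P := by
        rw [integral_sub (integrable_const _) haction, integral_const, probReal_univ, one_smul]
    _ ≤ ∫ ω, (1 - Real.exp (-1)) * ∫ s, ψ (x ω, s) ∂bqndLaw ∂P :=
        integral_mono ((integrable_const _).sub haction) (hint.const_mul _) fun ω =>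
          hf.exp_neg_one_mul_sub_le_integral_inner hf.nonneg (hK.subset_cube (hxK ω))
            (hK.subset_cube hy)
    _ = (1 - Real.exp (-1)) * ∫ ω, ψ (x ω, Z ω) ∂P := by rw [integral_const_mul, hfub]

end IsDRObjective

end OneQuery

section History

lemma mul_add_fin_lt {L T q : ℕ} (hq : (q + 1) * L ≤ T) (p : Fin L) : q * L + p < T := by
  have := p.2
  rw [Nat.succ_mul] at hq
  omega

lemma mul_add_fin_div {L : ℕ} (q : ℕ) (p : Fin L) : (q * L + p) / L = q := by
  rw [mul_comm, Nat.mul_add_div p.pos, Nat.div_eq_of_lt p.2, add_zero]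

variable {d L : ℕ} {Ω : Type*}

/-- What is known from the coins of the blocks before `m` and the feedback of the rounds before
`n`: the common form of `blockHistory` and `roundHistory`. -/
abbrev coinFeedbackHistory (z : ℕ → Ω → ℝ) (π : ℕ → Ω → Equiv.Perm (Fin L))
    (o : ℕ → Ω → EuclideanSpace ℝ (Fin d)) (m n : ℕ) : MeasurableSpace Ω :=
  (⨆ j : Fin m, MeasurableSpace.comap (z j) inferInstance) ⊔
  (⨆ j : Fin m, MeasurableSpace.comap (π j) ⊤) ⊔
  (⨆ t : Fin n, MeasurableSpace.comap (o t) inferInstance)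

variable {z : ℕ → Ω → ℝ} {π : ℕ → Ω → Equiv.Perm (Fin L)}
  {o : ℕ → Ω → EuclideanSpace ℝ (Fin d)} {m m' n n' : ℕ}

lemma roundHistory_eq (q : ℕ) (p : Fin L) :
    roundHistory z π o (q * L + p) = coinFeedbackHistory z π o (q + 1) (q * L + p) := by
  rw [roundHistory, mul_add_fin_div]

lemma comap_scalar_le_history {j : ℕ} (hj : j < m) :
    MeasurableSpace.comap (z j) inferInstance ≤ coinFeedbackHistory z π o m n :=
  le_sup_of_le_left <| le_sup_of_le_left <|
    le_iSup (fun j : Fin m => MeasurableSpace.comap (z j) inferInstance) ⟨j, hj⟩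

lemma comap_perm_le_history {j : ℕ} (hj : j < m) :
    MeasurableSpace.comap (π j) ⊤ ≤ coinFeedbackHistory z π o m n :=
  le_sup_of_le_left <| le_sup_of_le_right <|
    le_iSup (fun j : Fin m => MeasurableSpace.comap (π j) ⊤) ⟨j, hj⟩

lemma comap_feedback_le_history {t : ℕ} (ht : t < n) :
    MeasurableSpace.comap (o t) inferInstance ≤ coinFeedbackHistory z π o m n :=
  le_sup_of_le_right <|
    le_iSup (fun t : Fin n => MeasurableSpace.comap (o t) inferInstance) ⟨t, ht⟩

lemma coinFeedbackHistory_le {𝓜 : MeasurableSpace Ω}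
    (hz : ∀ j < m, MeasurableSpace.comap (z j) inferInstance ≤ 𝓜)
    (hπ : ∀ j < m, MeasurableSpace.comap (π j) ⊤ ≤ 𝓜)
    (ho : ∀ t < n, MeasurableSpace.comap (o t) inferInstance ≤ 𝓜) :
    coinFeedbackHistory z π o m n ≤ 𝓜 :=
  sup_le (sup_le (iSup_le fun j => hz j j.2) (iSup_le fun j => hπ j j.2))
    (iSup_le fun t => ho t t.2)

lemma coinFeedbackHistory_mono (hm : m ≤ m') (hn : n ≤ n') :
    coinFeedbackHistory z π o m n ≤ coinFeedbackHistory z π o m' n' :=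
  coinFeedbackHistory_le (fun _ hj => comap_scalar_le_history (hj.trans_le hm))
    (fun _ hj => comap_perm_le_history (hj.trans_le hm))
    (fun _ ht => comap_feedback_le_history (ht.trans_le hn))

lemma measurable_feedback_queryRound {𝓜 : MeasurableSpace Ω} (hL : 0 < L) {q : ℕ}
    (hπ : MeasurableSpace.comap (π q) ⊤ ≤ 𝓜) (ho : ∀ p : Fin L, Measurable (o (q * L + p))) :
    Measurable fun ω => o (queryRound hL (fun q => π q ω) q) ω := by
  let _ : MeasurableSpace (Equiv.Perm (Fin L)) := ⊤
  have hselect : Measurable fun p : Ω × Equiv.Perm (Fin L) =>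
      o (q * L + (p.2 ⟨0, hL⟩ : Fin L)) p.1 :=
    measurable_from_prod_countable_left fun σ => ho (σ ⟨0, hL⟩)
  exact hselect.comp (measurable_id.prodMk (measurable_iff_comap_le.2 hπ))

lemma measurable_baseIterate {K : Set (EuclideanSpace ℝ (Fin d))}
    {c : EuclideanSpace ℝ (Fin d)} {SO : EuclideanSpace ℝ (Fin d) → EuclideanSpace ℝ (Fin d)}
    {D δ η : ℝ} (hK : MeasurableSet K) (hSO : IsSeparationOracle K SO) (hSOm : Measurable SO)
    (hδ : 0 < δ) (hc : HasMargin K δ c) (hL : 0 < L) (q : ℕ) :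
    Measurable[blockHistory z π o q] fun ω => baseIterate K c D SO δ η hL (fun q => z q ω)
      (fun q => π q ω) (fun s => o s ω) q := by
  induction q with
  | zero => exact @measurable_const _ _ _ (blockHistory z π o 0) c
  | succ q ih =>
    let _ : MeasurableSpace Ω := blockHistory z π o (q + 1)
    have hx := ih.mono (coinFeedbackHistory_mono q.le_succ (Nat.mul_le_mul_right L q.le_succ))
      le_rfl
    have hz : Measurable (z q) :=
      measurable_iff_comap_le.2 (comap_scalar_le_history q.lt_succ_self)
    have ho : Measurable fun ω => o (queryRound hL (fun q => π q ω) q) ω :=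
      measurable_feedback_queryRound hL (comap_perm_le_history q.lt_succ_self) fun p =>
        measurable_iff_comap_le.2 (comap_feedback_le_history (mul_add_fin_lt le_rfl p))
    have hestimate := continuous_bqndEstimate.measurable.comp (hz.prodMk (hx.prodMk ho))
    exact (measurable_soIP hK hSO hSOm hδ hc).comp (hx.add (hestimate.const_smul η))

lemma IsSemiBanditRun.coinFeedbackHistory_le {mΩ : MeasurableSpace Ω} {P : Measure Ω} {T : ℕ}
    {B₁ : ℝ} {f : ℕ → EuclideanSpace ℝ (Fin d) → ℝ} {X : ℕ → Ω → EuclideanSpace ℝ (Fin d)}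
    (hrun : IsSemiBanditRun P T B₁ f z π o X) (hm : ∀ j < m, j * L < T) (hn : n ≤ T) :
    coinFeedbackHistory z π o m n ≤ mΩ :=
  _root_.coinFeedbackHistory_le (fun j hj => (hrun.measurable_z j (hm j hj)).comap_le)
    (fun j hj => comap_top_le_of_measurableSet_eq (hrun.measurable_perm j (hm j hj)))
    (fun t ht => (hrun.measurable_feedback t (ht.trans_le hn)).comap_le)

end History

section Blocking

variable {d L : ℕ} {Ω : Type*}

/-- The gradient estimate that the base learner receives in block `q`, when its iterate is `x q`. -/
def blockEstimate (hL : 0 < L) (x : ℕ → Ω → EuclideanSpace ℝ (Fin d)) (z : ℕ → Ω → ℝ)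
    (π : ℕ → Ω → Equiv.Perm (Fin L)) (o : ℕ → Ω → EuclideanSpace ℝ (Fin d)) (q : ℕ) (ω : Ω) :
    EuclideanSpace ℝ (Fin d) :=
  bqndEstimate (z q ω) (x q ω) (o (queryRound hL (fun q => π q ω) q) ω)

/-- A run of the blocking meta-algorithm over an arbitrary base learner with values in `K`: its
iterate in block `q` is `x q`, and it is only required not to look into the future. -/
structure IsBlockingRun {mΩ : MeasurableSpace Ω} (P : Measure Ω)
    (K : Set (EuclideanSpace ℝ (Fin d))) (D M₁ B₁ : ℝ) (T : ℕ)
    (f : ℕ → EuclideanSpace ℝ (Fin d) → ℝ) (hL : 0 < L) (x : ℕ → Ω → EuclideanSpace ℝ (Fin d))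
    (z : ℕ → Ω → ℝ) (π : ℕ → Ω → Equiv.Perm (Fin L))
    (o X : ℕ → Ω → EuclideanSpace ℝ (Fin d)) : Prop where
  feasible : IsFeasibleSet K D
  objective : ∀ t < T, IsDRObjective K M₁ (f t)
  run : IsSemiBanditRun P T B₁ f z π o X
  iterate_mem : ∀ q ω, x q ω ∈ K
  measurable_iterate : ∀ q, Measurable[blockHistory z π o q] (x q)
  played_eq : ∀ t ω, X t ω = if t = queryRound hL (fun q => π q ω) (t / L) then
    expMap (z (t / L) ω) (x (t / L) ω) else expMap 1 (x (t / L) ω)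

lemma add_eq_queryRound_iff {hL : 0 < L} {π : ℕ → Equiv.Perm (Fin L)} {q : ℕ} {p : Fin L} :
    q * L + p = queryRound hL π q ↔ π q ⟨0, hL⟩ = p := by
  rw [queryRound, Nat.add_left_cancel_iff, Fin.val_inj, eq_comm]

namespace IsBlockingRun

variable {mΩ : MeasurableSpace Ω} {P : Measure Ω}
  {K : Set (EuclideanSpace ℝ (Fin d))} {D M₁ B₁ : ℝ} {T : ℕ}
  {f : ℕ → EuclideanSpace ℝ (Fin d) → ℝ} {hL : 0 < L} {x : ℕ → Ω → EuclideanSpace ℝ (Fin d)}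
  {z : ℕ → Ω → ℝ} {π : ℕ → Ω → Equiv.Perm (Fin L)} {o X : ℕ → Ω → EuclideanSpace ℝ (Fin d)}
  {q t : ℕ} {y : EuclideanSpace ℝ (Fin d)}

lemma ae_scalar_mem (h : IsBlockingRun P K D M₁ B₁ T f hL x z π o X) (hq : q * L < T) :
    ∀ᵐ ω ∂P, z q ω ∈ Set.Icc (0 : ℝ) 1 :=
  ae_of_ae_map (h.run.measurable_z q hq).aemeasurable
    (by rw [h.run.law_z q hq]; exact ae_bqndLaw_mem)

lemma comap_perm_le (h : IsBlockingRun P K D M₁ B₁ T f hL x z π o X) (hq : q * L < T) :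
    MeasurableSpace.comap (π q) ⊤ ≤ mΩ :=
  comap_top_le_of_measurableSet_eq (h.run.measurable_perm q hq)

lemma measurable_iterate_of_le (h : IsBlockingRun P K D M₁ B₁ T f hL x z π o X)
    (hq : q * L ≤ T) : Measurable (x q) :=
  (h.measurable_iterate q).mono (h.run.coinFeedbackHistory_le
    (fun _ hj => (Nat.mul_lt_mul_of_pos_right hj hL).trans_le hq) hq) le_rfl

lemma action_mem (h : IsBlockingRun P K D M₁ B₁ T f hL x z π o X) (q : ℕ) (ω : Ω) :
    expMap 1 (x q ω) ∈ K :=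
  h.feasible.expMap_mem ⟨zero_le_one, le_rfl⟩ (h.iterate_mem q ω)

lemma ae_played_mem (h : IsBlockingRun P K D M₁ B₁ T f hL x z π o X) (ht : t < T) :
    ∀ᵐ ω ∂P, X t ω ∈ K := by
  filter_upwards [h.ae_scalar_mem ((Nat.div_mul_le_self t L).trans_lt ht)] with ω hω
  rw [h.played_eq]
  split_ifs
  exacts [h.feasible.expMap_mem hω (h.iterate_mem _ ω), h.action_mem _ ω]

lemma measurable_played (h : IsBlockingRun P K D M₁ B₁ T f hL x z π o X) (ht : t < T) :
    Measurable (X t) := by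
  have hq := (Nat.div_mul_le_self t L).trans_lt ht
  have hx := h.measurable_iterate_of_le hq.le
  rw [funext (h.played_eq t)]
  exact Measurable.ite
    (h.comap_perm_le hq _ ⟨{σ | t = t / L * L + (σ ⟨0, hL⟩ : Fin L)}, trivial, rfl⟩)
    (continuous_expMap.measurable.comp ((h.run.measurable_z _ hq).prodMk hx))
    (continuous_expMap.measurable.comp (measurable_const.prodMk hx))

lemma integrable_played [IsFiniteMeasure P] (h : IsBlockingRun P K D M₁ B₁ T f hL x z π o X)
    (ht : t < T) : Integrable (fun ω => f t (X t ω)) P :=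
  (h.objective t ht).integrable_comp h.feasible (h.measurable_played ht) (h.ae_played_mem ht)

lemma integrable_action [IsFiniteMeasure P] (h : IsBlockingRun P K D M₁ B₁ T f hL x z π o X)
    (ht : t < T) (hq : q * L ≤ T) : Integrable (fun ω => f t (expMap 1 (x q ω))) P :=
  (h.objective t ht).integrable_comp h.feasible
    (continuous_expMap.measurable.comp (measurable_const.prodMk (h.measurable_iterate_of_le hq)))
    (ae_of_all _ fun ω => h.action_mem q ω)

lemma measurable_blockEstimate (h : IsBlockingRun P K D M₁ B₁ T f hL x z π o X)
    (hq : (q + 1) * L ≤ T) : Measurable (blockEstimate hL x z π o q) := by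
  have hqT : q * L < T := mul_add_fin_lt hq ⟨0, hL⟩
  exact continuous_bqndEstimate.measurable.comp ((h.run.measurable_z q hqT).prodMk
    ((h.measurable_iterate_of_le hqT.le).prodMk (measurable_feedback_queryRound hL
      (h.comap_perm_le hqT) fun p => h.run.measurable_feedback _ (mul_add_fin_lt hq p))))

lemma ae_norm_blockEstimate_le (h : IsBlockingRun P K D M₁ B₁ T f hL x z π o X)
    (hq : (q + 1) * L ≤ T) : ∀ᵐ ω ∂P, ‖blockEstimate hL x z π o q ω‖ ≤ B₁ := by
  have hfeedback : ∀ᵐ ω ∂P, ∀ p : Fin L, ‖o (q * L + p) ω‖ ≤ B₁ :=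
    ae_all_iff.2 fun p => h.run.bounded _ (mul_add_fin_lt hq p)
  filter_upwards [hfeedback, h.ae_scalar_mem (mul_add_fin_lt hq ⟨0, hL⟩)] with ω ho hz
  exact (norm_bqndEstimate_le hz.1 (h.feasible.subset_cube (h.iterate_mem q ω)) _).trans
    (ho (π q ω ⟨0, hL⟩))

lemma integrable_inner_blockEstimate [IsFiniteMeasure P]
    (h : IsBlockingRun P K D M₁ B₁ T f hL x z π o X) (hq : (q + 1) * L ≤ T) (hy : y ∈ K) :
    Integrable (fun ω => inner ℝ (blockEstimate hL x z π o q ω) (y - x q ω)) P :=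
  integrable_inner_of_norm_le (h.measurable_blockEstimate hq).aestronglyMeasurable
    ((h.measurable_iterate_of_le (mul_add_fin_lt hq ⟨0, hL⟩).le).const_sub y).aestronglyMeasurable
    (h.ae_norm_blockEstimate_le hq)
    (ae_of_all _ fun ω => h.feasible.dist_le y hy _ (h.iterate_mem q ω))

lemma integral_inner_blockEstimate [IsFiniteMeasure P]
    (h : IsBlockingRun P K D M₁ B₁ T f hL x z π o X) (hq : (q + 1) * L ≤ T) (hy : y ∈ K) :
    ∫ ω, inner ℝ (blockEstimate hL x z π o q ω) (y - x q ω) ∂P =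
      ∑ p : Fin L, ∫ ω in {ω | π q ω ⟨0, hL⟩ = p},
        inner ℝ (o (q * L + p) ω) (bqndEstimate (z q ω) (x q ω) (y - x q ω)) ∂P := by
  have hA (p : Fin L) : MeasurableSet {ω | π q ω ⟨0, hL⟩ = p} :=
    h.comap_perm_le (mul_add_fin_lt hq ⟨0, hL⟩) _ ⟨{σ | σ ⟨0, hL⟩ = p}, trivial, rfl⟩
  have hcover : ⋃ p : Fin L, {ω | π q ω ⟨0, hL⟩ = p} = Set.univ :=
    Set.iUnion_eq_univ_iff.2 fun ω => ⟨_, rfl⟩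
  rw [← setIntegral_univ, ← hcover, integral_iUnion_fintype hA
    (fun p p' hne => Set.disjoint_left.2 fun ω hp hp' => hne (hp.symm.trans hp'))
    fun p => (h.integrable_inner_blockEstimate hq hy).integrableOn]
  refine Finset.sum_congr rfl fun p _ => setIntegral_congr_fun (hA p) fun ω hω => ?_
  change inner ℝ (bqndEstimate _ _ (o (q * L + (π q ω ⟨0, hL⟩ : Fin L)) ω)) _ = _
  rw [show π q ω ⟨0, hL⟩ = p from hω, inner_bqndEstimate_left]

lemma roundHistory_le (h : IsBlockingRun P K D M₁ B₁ T f hL x z π o X) (hq : (q + 1) * L ≤ T)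
    (p : Fin L) : roundHistory z π o (q * L + p) ≤ mΩ := by
  rw [roundHistory_eq]
  exact h.run.coinFeedbackHistory_le (fun j hj => (Nat.mul_le_mul_right L
    (Nat.lt_succ_iff.1 hj)).trans_lt (mul_add_fin_lt hq ⟨0, hL⟩)) (mul_add_fin_lt hq p).le

lemma measureReal_perm_zero_eq (h : IsBlockingRun P K D M₁ B₁ T f hL x z π o X)
    (hq : q * L < T) (p : Fin L) : P.real {ω | π q ω ⟨0, hL⟩ = p} = (L : ℝ)⁻¹ := by
  simpa only [Fintype.card_fin] using measureReal_perm_apply_eq (h.run.measurable_perm q hq)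
    (by simpa only [Fintype.card_fin] using h.run.law_perm q hq) ⟨0, hL⟩ p

lemma condExp_feedback_eq_of_perm_zero_eq (h : IsBlockingRun P K D M₁ B₁ T f hL x z π o X)
    (hq : (q + 1) * L ≤ T) (p : Fin L) : ∀ᵐ ω ∂P, π q ω ⟨0, hL⟩ = p →
      (P[o (q * L + p) | roundHistory z π o (q * L + p)]) ω =
        cubeGrad (f (q * L + p)) (expMap (z q ω) (x q ω)) := by
  filter_upwards [h.run.unbiased _ (mul_add_fin_lt hq p)] with ω hω hωp
  rw [hω, h.played_eq, mul_add_fin_div, if_pos (add_eq_queryRound_iff.2 hωp)]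

lemma setIntegral_inner_feedback [IsFiniteMeasure P]
    (h : IsBlockingRun P K D M₁ B₁ T f hL x z π o X) (hq : (q + 1) * L ≤ T) (hy : y ∈ K)
    (p : Fin L) :
    ∫ ω in {ω | π q ω ⟨0, hL⟩ = p},
        inner ℝ (o (q * L + p) ω) (bqndEstimate (z q ω) (x q ω) (y - x q ω)) ∂P =
      (L : ℝ)⁻¹ * ∫ ω, inner ℝ (cubeGrad (f (q * L + p)) (expMap (z q ω) (x q ω)))
        (bqndEstimate (z q ω) (x q ω) (y - x q ω)) ∂P := by
  have hqT : q * L < T := mul_add_fin_lt hq ⟨0, hL⟩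
  have htT := mul_add_fin_lt hq p
  have hobj := h.objective _ htT
  have hscalar := h.ae_scalar_mem hqT
  have hfeedback := (h.run.measurable_feedback _ htT).aestronglyMeasurable (μ := P)
  have hpast : blockHistory z π o q ⊔ MeasurableSpace.comap (z q) inferInstance ≤
      roundHistory z π o (q * L + p) := by
    rw [roundHistory_eq]
    exact sup_le (coinFeedbackHistory_mono q.le_succ (Nat.le_add_right _ _))
      (comap_scalar_le_history q.lt_succ_self)
  have hperm : MeasurableSpace.comap (π q) ⊤ ≤ roundHistory z π o (q * L + p) := by
    rw [roundHistory_eq]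
    exact comap_perm_le_history q.lt_succ_self
  have hzx : Measurable[blockHistory z π o q ⊔ MeasurableSpace.comap (z q) inferInstance]
      fun ω => (z q ω, x q ω) :=
    (measurable_iff_comap_le.2 le_sup_right).prodMk
      ((h.measurable_iterate q).mono le_sup_left le_rfl)
  have hgrad := ((measurable_cubeGrad hobj.differentiableOn).comp
    (continuous_expMap.measurable.comp hzx)).stronglyMeasurable
  have hdir := (continuous_bqndEstimate.measurable.comp
    (hzx.fst.prodMk (hzx.snd.prodMk (hzx.snd.const_sub y)))).stronglyMeasurable
  rw [← h.measureReal_perm_zero_eq hqT p]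
  exact setIntegral_inner_eq_measureReal_mul_integral_inner (h.roundHistory_le hq p) hpast hperm
    (h.run.indep_perm q hqT) (.of_bound hfeedback B₁ (h.run.bounded _ htT)) hgrad hdir
    (integrable_inner_of_norm_le hfeedback
      (hdir.mono (hpast.trans (h.roundHistory_le hq p))).aestronglyMeasurable
      (h.run.bounded _ htT)
      (hscalar.mono fun ω hω => h.feasible.norm_bqndEstimate_sub_le hω.1 (h.iterate_mem q ω) hy))
    (hobj.integrable_inner_cubeGrad_expMap h.feasible (h.measurable_iterate_of_le hqT.le)
      (h.iterate_mem q) (h.run.measurable_z q hqT) hscalar hy)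
    ⟨{σ | σ ⟨0, hL⟩ = p}, trivial, rfl⟩ (h.condExp_feedback_eq_of_perm_zero_eq hq p)

lemma sum_action_gap_le [IsProbabilityMeasure P] (h : IsBlockingRun P K D M₁ B₁ T f hL x z π o X)
    (hq : (q + 1) * L ≤ T) (hy : y ∈ K) :
    ∑ p : Fin L, (Real.exp (-1) * f (q * L + p) y -
        ∫ ω, f (q * L + p) (expMap 1 (x q ω)) ∂P) ≤
      (1 - Real.exp (-1)) *
        (L * ∫ ω, inner ℝ (blockEstimate hL x z π o q ω) (y - x q ω) ∂P) := by
  have hqT : q * L < T := mul_add_fin_lt hq ⟨0, hL⟩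
  have hind : IndepFun (x q) (z q) P :=
    indep_of_indep_of_le_left (h.run.indep_z q hqT).symm (h.measurable_iterate q).comap_le
  have hL0 : (L : ℝ) ≠ 0 := by exact_mod_cast hL.ne'
  rw [h.integral_inner_blockEstimate hq hy, Finset.mul_sum, Finset.mul_sum]
  refine Finset.sum_le_sum fun p _ => ?_
  rw [h.setIntegral_inner_feedback hq hy p, mul_inv_cancel_left₀ hL0]
  exact (h.objective _ (mul_add_fin_lt hq p)).sub_integral_le_integral_inner h.feasible
    (h.measurable_iterate_of_le hqT.le) (h.iterate_mem q) (h.run.measurable_z q hqT)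
    (h.run.law_z q hqT) hind hy

lemma sum_action_sub_played_le [IsProbabilityMeasure P]
    (h : IsBlockingRun P K D M₁ B₁ T f hL x z π o X) (hq : (q + 1) * L ≤ T) :
    ∑ p : Fin L, (∫ ω, f (q * L + p) (expMap 1 (x q ω)) ∂P -
      ∫ ω, f (q * L + p) (X (q * L + p) ω) ∂P) ≤ M₁ * D := by
  have htT := mul_add_fin_lt hq
  have haction (p : Fin L) := h.integrable_action (htT p) (mul_add_fin_lt hq ⟨0, hL⟩).le
  have hplayed (p : Fin L) := h.integrable_played (htT p)
  have hdiff (p : Fin L) : Integrable (fun ω => f (q * L + p) (expMap 1 (x q ω)) -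
      f (q * L + p) (X (q * L + p) ω)) P := (haction p).sub (hplayed p)
  have hbound : ∀ᵐ ω ∂P, ∑ p : Fin L, (f (q * L + p) (expMap 1 (x q ω)) -
      f (q * L + p) (X (q * L + p) ω)) ≤ M₁ * D := by
    filter_upwards [ae_all_iff.2 fun p : Fin L => h.ae_played_mem (htT p)] with ω hω
    rw [Finset.sum_eq_single (π q ω ⟨0, hL⟩) _ (by simp)]
    · exact (h.objective _ (htT _)).sub_le h.feasible (hω _) (h.action_mem q ω)
    · intro p _ hp
      rw [h.played_eq, mul_add_fin_div, if_neg fun hquery =>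
        hp (add_eq_queryRound_iff.1 hquery).symm, sub_self]
  rw [Finset.sum_congr rfl fun p _ => (integral_sub (haction p) (hplayed p)).symm,
    ← integral_finsetSum _ fun p _ => hdiff p]
  simpa only [integral_const, probReal_univ, one_smul] using integral_mono_ae
    (integrable_finsetSum _ fun p _ => hdiff p) (integrable_const _) hbound

lemma gap_le [IsProbabilityMeasure P] (h : IsBlockingRun P K D M₁ B₁ T f hL x z π o X)
    (ht : t < T) (hy : y ∈ K) :
    Real.exp (-1) * f t y - ∫ ω, f t (X t ω) ∂P ≤ M₁ * D := by
  have hmean : ∫ _, (f t y - M₁ * D) ∂P ≤ ∫ ω, f t (X t ω) ∂P := by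
    refine integral_mono_ae (integrable_const _) (h.integrable_played ht) ?_
    filter_upwards [h.ae_played_mem ht] with ω hω
    linarith [(h.objective t ht).sub_le h.feasible hω hy]
  have hexp : Real.exp (-1) * f t y ≤ f t y :=
    mul_le_of_le_one_left ((h.objective t ht).nonneg y (h.feasible.subset_cube hy))
      (Real.exp_le_one_iff.2 (by norm_num))
  rw [integral_const, probReal_univ, one_smul] at hmean
  linarith

lemma sum_block_gap_le [IsProbabilityMeasure P] (h : IsBlockingRun P K D M₁ B₁ T f hL x z π o X)
    (hq : (q + 1) * L ≤ T) (hy : y ∈ K) :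
    ∑ p : Fin L, (Real.exp (-1) * f (q * L + p) y - ∫ ω, f (q * L + p) (X (q * L + p) ω) ∂P) ≤
      (1 - Real.exp (-1)) * L * ∫ ω, inner ℝ (blockEstimate hL x z π o q ω) (y - x q ω) ∂P +
        M₁ * D := by
  have hsum := add_le_add (h.sum_action_gap_le hq hy) (h.sum_action_sub_played_le hq)
  simpa only [← Finset.sum_add_distrib, sub_add_sub_cancel, mul_assoc] using hsum

end IsBlockingRun

lemma sum_Ico_mul_eq_sum_sum_fin (G : ℕ → ℝ) (L : ℕ) {q₀ q₁ : ℕ} (hq : q₀ ≤ q₁) :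
    ∑ t ∈ Finset.Ico (q₀ * L) (q₁ * L), G t =
      ∑ q ∈ Finset.Ico q₀ q₁, ∑ p : Fin L, G (q * L + p) := by
  induction q₁, hq using Nat.le_induction with
  | base => simp
  | succ q hq ih =>
    rw [Finset.sum_Ico_succ_top hq, ← ih,
      ← Finset.sum_Ico_consecutive G (Nat.mul_le_mul_right L hq)
        (Nat.mul_le_mul_right L q.le_succ), Finset.sum_Ico_eq_sum_range G (q * L),
      Fin.sum_univ_eq_sum_range (fun p => G (q * L + p)), Nat.succ_mul, Nat.add_sub_cancel_left]

lemma sum_Ico_le_mul {G : ℕ → ℝ} {m : ℝ} (hm : 0 ≤ m) {a b n : ℕ} (hn : b ≤ a + n)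
    (hG : ∀ t < b, G t ≤ m) : ∑ t ∈ Finset.Ico a b, G t ≤ n * m := by
  refine (Finset.sum_le_card_nsmul _ _ m fun t ht => hG t (Finset.mem_Ico.1 ht).2).trans ?_
  rw [nsmul_eq_mul, Nat.card_Ico]
  gcongr
  omega

lemma exists_sum_Icc_le_add_sum_blocks {G : ℕ → ℝ} {m : ℝ} (hm : 0 ≤ m) {L T b : ℕ} (hL : 0 < L)
    (a : ℕ) (hb : b < T) (hG : ∀ t < T, G t ≤ m) : ∃ q₀ q₁ : ℕ, q₀ ≤ q₁ ∧ q₁ * L ≤ T ∧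
      ∑ t ∈ Finset.Icc a b, G t ≤
        2 * L * m + ∑ q ∈ Finset.Ico q₀ q₁, ∑ p : Fin L, G (q * L + p) := by
  have hlast_le : (b + 1) / L * L ≤ b + 1 := Nat.div_mul_le_self _ _
  have hlast_gt : b + 1 < (b + 1) / L * L + L := Nat.lt_div_mul_add hL
  have hfirst_ge : a ≤ (a + L - 1) / L * L := by
    have := Nat.lt_div_mul_add (a := a + L - 1) hL
    omega
  have hfirst_lt : (a + L - 1) / L * L < a + L := by
    have := Nat.div_mul_le_self (a + L - 1) L
    omega
  have hG' {n : ℕ} (hn : n ≤ b + 1) : ∀ t < n, G t ≤ m := fun t ht => hG t (by omega)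
  rw [← Finset.Ico_add_one_right_eq_Icc]
  rcases le_or_gt ((a + L - 1) / L) ((b + 1) / L) with hle | hlt
  · have hmul := Nat.mul_le_mul_right L hle
    refine ⟨_, _, hle, hlast_le.trans hb, ?_⟩
    rw [← sum_Ico_mul_eq_sum_sum_fin G L hle,
      ← Finset.sum_Ico_consecutive G hfirst_ge (hmul.trans hlast_le),
      ← Finset.sum_Ico_consecutive G hmul hlast_le]
    linarith [sum_Ico_le_mul hm hfirst_lt.le (hG' (hmul.trans hlast_le)),
      sum_Ico_le_mul hm hlast_gt.le (hG' le_rfl)]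
  · refine ⟨0, 0, le_rfl, by simp, ?_⟩
    have hmul := Nat.mul_le_mul_right L hlt
    rw [Nat.succ_mul] at hmul
    simpa using sum_Ico_le_mul (a := a) (n := 2 * L) hm (by omega) (hG' le_rfl)

lemma IsBlockingRun.sum_gap_le {mΩ : MeasurableSpace Ω} {P : Measure Ω} [IsProbabilityMeasure P]
    {K : Set (EuclideanSpace ℝ (Fin d))} {D M₁ B₁ R : ℝ} {T b : ℕ}
    {f : ℕ → EuclideanSpace ℝ (Fin d) → ℝ} {hL : 0 < L} {x : ℕ → Ω → EuclideanSpace ℝ (Fin d)}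
    {z : ℕ → Ω → ℝ} {π : ℕ → Ω → Equiv.Perm (Fin L)} {o X : ℕ → Ω → EuclideanSpace ℝ (Fin d)}
    {y : EuclideanSpace ℝ (Fin d)} (h : IsBlockingRun P K D M₁ B₁ T f hL x z π o X) (hy : y ∈ K)
    (hR : ∀ q₀ q₁, q₀ ≤ q₁ → q₁ * L ≤ T → ∑ q ∈ Finset.Ico q₀ q₁,
      ∫ ω, inner ℝ (blockEstimate hL x z π o q ω) (y - x q ω) ∂P ≤ R) (a : ℕ) (hb : b < T) :
    ∑ t ∈ Finset.Icc a b, (Real.exp (-1) * f t y - ∫ ω, f t (X t ω) ∂P) ≤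
      2 * L * (M₁ * D) + T / L * (M₁ * D) + L * R := by
  have hR₀ : 0 ≤ R := by simpa using hR 0 0 le_rfl (by simp)
  have hMD : 0 ≤ M₁ * D := by simpa using (h.objective b hb).sub_le h.feasible hy hy
  have hL₀ : (0 : ℝ) < L := by exact_mod_cast hL
  obtain ⟨q₀, q₁, hq, hq₁, hsum⟩ :=
    exists_sum_Icc_le_add_sum_blocks hMD hL a hb fun t ht => h.gap_le ht hy
  have hcard : ((q₁ - q₀ : ℕ) : ℝ) ≤ T / L := by
    rw [le_div_iff₀ hL₀]
    exact_mod_cast (Nat.mul_le_mul_right L (Nat.sub_le q₁ q₀)).trans hq₁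
  have hweight₀ : 0 ≤ (1 - Real.exp (-1)) * L := mul_nonneg one_sub_exp_neg_one_pos.le hL₀.le
  have hweight₁ : (1 - Real.exp (-1)) * L ≤ L :=
    mul_le_of_le_one_left hL₀.le (by linarith [Real.exp_pos (-1)])
  have hblocks := Finset.sum_le_sum fun q (hqm : q ∈ Finset.Ico q₀ q₁) => h.sum_block_gap_le
    ((Nat.mul_le_mul_right L (Finset.mem_Ico.1 hqm).2).trans hq₁) hy
  rw [Finset.sum_add_distrib, ← Finset.mul_sum, Finset.sum_const, Nat.card_Ico,
    nsmul_eq_mul] at hblocks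
  linarith [mul_le_mul_of_nonneg_right hcard hMD, mul_le_mul_of_nonneg_right hweight₁ hR₀,
    mul_le_mul_of_nonneg_left (hR q₀ q₁ hq hq₁) hweight₀]

end Blocking

section BaseLearner

variable {d L : ℕ} {Ω : Type*} {mΩ : MeasurableSpace Ω} {P : Measure Ω}
  {K : Set (EuclideanSpace ℝ (Fin d))} {c : EuclideanSpace ℝ (Fin d)} {D r : ℝ}
  {SO : EuclideanSpace ℝ (Fin d) → EuclideanSpace ℝ (Fin d)} {M₁ B₁ : ℝ} {T : ℕ}
  {f : ℕ → EuclideanSpace ℝ (Fin d) → ℝ} {δ η : ℝ} {hL : 0 < L}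
  {z : ℕ → Ω → ℝ} {π : ℕ → Ω → Equiv.Perm (Fin L)} {o X : ℕ → Ω → EuclideanSpace ℝ (Fin d)}

lemma baseIterate_mem (hSO : IsSeparationOracle K SO) (hδ : 0 < δ) (hc : HasMargin K δ c)
    (hL : 0 < L) (z : ℕ → ℝ) (π : ℕ → Equiv.Perm (Fin L)) (o : ℕ → EuclideanSpace ℝ (Fin d)) :
    ∀ q, baseIterate K c D SO δ η hL z π o q ∈ K
  | 0 => hc.mem hδ
  | _ + 1 => soIP_mem hSO hδ hc _

lemma isBlockingRun_baseIterate (hK : IsFeasibleSet K D) (hf : ∀ t < T, IsDRObjective K M₁ (f t))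
    (hrun : IsSemiBanditRun P T B₁ f z π o X) (hSO : IsSeparationOracle K SO)
    (hSOm : Measurable SO) (hδ : 0 < δ) (hc : HasMargin K δ c)
    (hX : ∀ t ω, X t ω = playedAction K c D SO δ η hL (fun q => z q ω) (fun q => π q ω)
      (fun s => o s ω) t) :
    IsBlockingRun P K D M₁ B₁ T f hL (fun q ω => baseIterate K c D SO δ η hL (fun q => z q ω)
      (fun q => π q ω) (fun s => o s ω) q) z π o X where
  feasible := hK
  objective := hf
  run := hrun
  iterate_mem q _ := baseIterate_mem hSO hδ hc hL _ _ _ q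
  measurable_iterate := measurable_baseIterate hK.measurableSet hSO hSOm hδ hc hL
  played_eq := hX

lemma IsBlockingRun.sum_integral_inner_blockEstimate_le [IsProbabilityMeasure P]
    {x : ℕ → Ω → EuclideanSpace ℝ (Fin d)} (h : IsBlockingRun P K D M₁ B₁ T f hL x z π o X)
    (hx : ∀ q ω, x (q + 1) ω = soOGAStep K c D SO δ η (x q ω) (blockEstimate hL x z π o q ω))
    (hSO : IsSeparationOracle K SO) (hD : 0 < D) (hδ : 0 < δ) (hδr : δ ≤ r)
    (hc : HasMargin K r c) (hη : 0 < η) {y : EuclideanSpace ℝ (Fin d)} (hy : y ∈ K) {q₀ q₁ : ℕ}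
    (hq : q₀ ≤ q₁) (hq₁ : q₁ * L ≤ T) :
    ∑ q ∈ Finset.Ico q₀ q₁, ∫ ω, inner ℝ (blockEstimate hL x z π o q ω) (y - x q ω) ∂P ≤
      D ^ 2 / (2 * η) + (q₁ - q₀ : ℕ) * (η * B₁ ^ 2 / 2 + B₁ * (δ / r * D)) := by
  have hqT : ∀ q ∈ Finset.Ico q₀ q₁, (q + 1) * L ≤ T := fun q hqm =>
    (Nat.mul_le_mul_right L (Finset.mem_Ico.1 hqm).2).trans hq₁
  have hint := fun q hqm => h.integrable_inner_blockEstimate (hqT q hqm) hy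
  have hnorm : ∀ᵐ ω ∂P, ∀ q ∈ Finset.Ico q₀ q₁, ‖blockEstimate hL x z π o q ω‖ ≤ B₁ :=
    (Finset.eventually_all _).2 fun q hqm => h.ae_norm_blockEstimate_le (hqT q hqm)
  rw [← integral_finsetSum _ hint]
  simpa only [integral_const, probReal_univ, one_smul] using integral_mono_ae
    (integrable_finsetSum _ hint) (integrable_const _) <| hnorm.mono fun ω hω =>
      sum_inner_le_of_soOGAStep h.feasible.convex h.feasible.dist_le hSO hD hδ hδr hc hη hq
        (x := fun q => x q ω) (h.iterate_mem q₀ ω) hω (fun q _ => hx q ω) hy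

end BaseLearner

section Rates

lemma one_le_rpow_third {T : ℕ} (hT : 1 ≤ T) : 1 ≤ (T : ℝ) ^ (1 / 3 : ℝ) :=
  Real.one_le_rpow (by exact_mod_cast hT) (by norm_num)

lemma rpow_third_pow (T n : ℕ) : ((T : ℝ) ^ (1 / 3 : ℝ)) ^ n = (T : ℝ) ^ (n / 3 : ℝ) := by
  rw [← Real.rpow_mul_natCast T.cast_nonneg, one_div_mul_eq_div]

lemma blockSize_le {T : ℕ} (hT : 1 ≤ T) : (blockSize T : ℝ) ≤ 2 * (T : ℝ) ^ (1 / 3 : ℝ) := by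
  have hone := one_le_rpow_third hT
  have hceil : (blockSize T : ℝ) < _ := Nat.ceil_lt_add_one (zero_le_one.trans hone)
  linarith

lemma div_blockSize_le (T : ℕ) : (T : ℝ) / blockSize T ≤ ((T : ℝ) ^ (1 / 3 : ℝ)) ^ 2 := by
  have hcube : ((T : ℝ) ^ (1 / 3 : ℝ)) ^ 3 = T := by
    rw [rpow_third_pow]
    norm_num
  refine div_le_of_le_mul₀ (Nat.cast_nonneg _) (sq_nonneg _) ?_
  conv_lhs => rw [← hcube, pow_succ]
  exact mul_le_mul_of_nonneg_left (Nat.le_ceil _) (sq_nonneg _)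

lemma numBlocks_pos {T : ℕ} (hT : 1 ≤ T) : 0 < numBlocks T :=
  Nat.ceil_pos.2 (div_pos (by exact_mod_cast hT) (by exact_mod_cast blockSize_pos hT))

lemma numBlocks_le {T : ℕ} (hT : 1 ≤ T) :
    (numBlocks T : ℝ) ≤ 2 * ((T : ℝ) ^ (1 / 3 : ℝ)) ^ 2 := by
  have hceil : (numBlocks T : ℝ) < _ := Nat.ceil_lt_add_one (by positivity)
  linarith [div_blockSize_le T, one_le_pow₀ (one_le_rpow_third hT) (n := 2)]

/-- The regret constant of the base learner: with its step size and margin tuned to `N` blocks,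
its linear regret against estimates of norm at most `B` is at most `√N * B` times it. -/
def baseRegretConst (D r v : ℝ) : ℝ := D ^ 2 / (v * r) + v * r / 4 + v * D / r

lemma tuned_linear_regret_eq {D r v B N s : ℝ} (hr : r ≠ 0) (hv : v ≠ 0) (hB : B ≠ 0)
    (hs : s ≠ 0) (hsN : s ^ 2 = N) :
    D ^ 2 / (2 * (v * r / (2 * B) * s⁻¹)) +
        N * (v * r / (2 * B) * s⁻¹ * B ^ 2 / 2 + B * (v * s⁻¹ / r * D)) =
      s * B * baseRegretConst D r v := by
  rw [baseRegretConst, ← hsN]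
  field_simp
  ring

lemma total_regret_le {D k M B L N s τ : ℝ} (hD : 0 ≤ D) (hk : 0 ≤ k) (hM : 0 ≤ M) (hB : 0 ≤ B)
    (hτ : 1 ≤ τ) (hL : L ≤ 2 * τ) (hN : N ≤ 2 * τ ^ 2) (hs : 0 ≤ s) (hsN : s ^ 2 = N) :
    2 * L * (M * D) + N * (M * D) + L * (s * B * k) ≤ (6 * D + 4 * k) * (M + B) * τ ^ 2 := by
  have hsτ : s ≤ 2 * τ := le_of_sq_le_sq (by nlinarith [sq_nonneg τ]) (by linarith)
  have hLτ : L ≤ 2 * τ ^ 2 := by nlinarith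
  calc 2 * L * (M * D) + N * (M * D) + L * (s * B * k)
      ≤ 2 * (2 * τ ^ 2) * (M * D) + 2 * τ ^ 2 * (M * D) + 2 * τ * (2 * τ * B * k) := by gcongr
    _ = (6 * D * M + 4 * k * B) * τ ^ 2 := by ring
    _ ≤ (6 * D * (M + B) + 4 * k * (M + B)) * τ ^ 2 := by gcongr <;> linarith
    _ = (6 * D + 4 * k) * (M + B) * τ ^ 2 := by ring

end Rates

section Regret

variable {d : ℕ} {Ω : Type*} {mΩ : MeasurableSpace Ω} {P : Measure Ω} {α R : ℝ}
  {K : Set (EuclideanSpace ℝ (Fin d))} {f : ℕ → EuclideanSpace ℝ (Fin d) → ℝ}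
  {X : ℕ → Ω → EuclideanSpace ℝ (Fin d)} {T : ℕ}

lemma regretOn_le (hα : 0 < α) (hK : K.Nonempty) {I : Finset ℕ}
    (h : ∀ y ∈ K, ∑ t ∈ I, (α * f t y - ∫ ω, f t (X t ω) ∂P) ≤ R) :
    regretOn P α K f X I ≤ R := by
  have hsup : sSup ((fun y => ∑ t ∈ I, f t y) '' K) ≤
      (R + ∑ t ∈ I, ∫ ω, f t (X t ω) ∂P) / α := by
    refine csSup_le (hK.image _) (Set.forall_mem_image.2 fun y hy => ?_)
    have hy := h y hy
    rw [Finset.sum_sub_distrib, ← Finset.mul_sum] at hy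
    rw [le_div_iff₀ hα]
    linarith
  rw [le_div_iff₀ hα] at hsup
  rw [regretOn]
  linarith

lemma staticRegret_le (hT : 1 ≤ T)
    (h : ∀ a b, b < T → regretOn P α K f X (Finset.Icc a b) ≤ R) :
    staticRegret P α K f X T ≤ R := by
  have hlast : T - 1 + 1 = T := Nat.sub_add_cancel hT
  rw [staticRegret, Finset.range_eq_Ico, ← hlast, Finset.Ico_add_one_right_eq_Icc]
  exact h 0 (T - 1) (by omega)

lemma adaptiveRegret_le (hT : 1 ≤ T)
    (h : ∀ a b, b < T → regretOn P α K f X (Finset.Icc a b) ≤ R) :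
    adaptiveRegret P α K f X T ≤ R := by
  refine csSup_le ⟨_, 0, 0, le_rfl, hT, rfl⟩ ?_
  rintro _ ⟨a, b, -, hb, rfl⟩
  exact h a b hb

lemma IsBlockingRun.regretOn_Icc_le [IsProbabilityMeasure P] {c : EuclideanSpace ℝ (Fin d)}
    {SO : EuclideanSpace ℝ (Fin d) → EuclideanSpace ℝ (Fin d)} {D r v M₁ B₁ δ η : ℝ} {hT : 1 ≤ T}
    {x : ℕ → Ω → EuclideanSpace ℝ (Fin d)} {z : ℕ → Ω → ℝ}
    {π : ℕ → Ω → Equiv.Perm (Fin (blockSize T))} {o : ℕ → Ω → EuclideanSpace ℝ (Fin d)}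
    (h : IsBlockingRun P K D M₁ B₁ T f (blockSize_pos hT) x z π o X)
    (hx : ∀ q ω, x (q + 1) ω = soOGAStep K c D SO δ η (x q ω)
      (blockEstimate (blockSize_pos hT) x z π o q ω))
    (hSO : IsSeparationOracle K SO) (hc : HasMargin K r c) (hD : 0 < D) (hr : 0 < r) (hv : 0 < v)
    (hB : 0 < B₁) (hδ : δ = v * (√(numBlocks T))⁻¹) (hδr : δ ≤ r)
    (hη : η = v * r / (2 * B₁) * (√(numBlocks T))⁻¹) (a : ℕ) {b : ℕ} (hb : b < T) :
    regretOn P (Real.exp (-1)) K f X (Finset.Icc a b) ≤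
      (6 * D + 4 * baseRegretConst D r v) * (M₁ + B₁) * (T : ℝ) ^ (2 / 3 : ℝ) := by
  have hcK : c ∈ K := hc.mem hr
  have hM : 0 ≤ M₁ := (norm_nonneg _).trans ((h.objective 0 hT).norm_cubeGrad_le c hcK)
  have hs : 0 < √(numBlocks T : ℝ) := Real.sqrt_pos.2 (by exact_mod_cast numBlocks_pos hT)
  have hsN : √(numBlocks T : ℝ) ^ 2 = numBlocks T := Real.sq_sqrt (Nat.cast_nonneg _)
  have hδ₀ : 0 < δ := by rw [hδ]; positivity
  have hη₀ : 0 < η := by rw [hη]; positivity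
  have hk : 0 ≤ baseRegretConst D r v := by rw [baseRegretConst]; positivity
  have hT₀ : (T : ℝ) / blockSize T ≤ numBlocks T := Nat.le_ceil _
  refine regretOn_le (Real.exp_pos _) ⟨c, hcK⟩ fun y hy => ?_
  have hbase (q₀ q₁ : ℕ) (hq : q₀ ≤ q₁) (hq₁ : q₁ * blockSize T ≤ T) :
      ∑ q ∈ Finset.Ico q₀ q₁, ∫ ω, inner ℝ (blockEstimate (blockSize_pos hT) x z π o q ω)
        (y - x q ω) ∂P ≤ √(numBlocks T) * B₁ * baseRegretConst D r v := by
    have hcard : ((q₁ - q₀ : ℕ) : ℝ) ≤ numBlocks T := by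
      refine le_trans ?_ hT₀
      rw [le_div_iff₀ (by exact_mod_cast blockSize_pos hT)]
      exact_mod_cast (Nat.mul_le_mul_right _ (Nat.sub_le q₁ q₀)).trans hq₁
    rw [← tuned_linear_regret_eq hr.ne' hv.ne' hB.ne' hs.ne' hsN, ← hδ, ← hη]
    refine (h.sum_integral_inner_blockEstimate_le hx hSO hD hδ₀ hδr hc hη₀ hy hq hq₁).trans ?_
    gcongr
  calc ∑ t ∈ Finset.Icc a b, (Real.exp (-1) * f t y - ∫ ω, f t (X t ω) ∂P)
      ≤ 2 * blockSize T * (M₁ * D) + T / blockSize T * (M₁ * D) +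
          blockSize T * (√(numBlocks T) * B₁ * baseRegretConst D r v) :=
        h.sum_gap_le hy hbase a hb
    _ ≤ 2 * blockSize T * (M₁ * D) + numBlocks T * (M₁ * D) +
          blockSize T * (√(numBlocks T) * B₁ * baseRegretConst D r v) := by gcongr
    _ ≤ (6 * D + 4 * baseRegretConst D r v) * (M₁ + B₁) * ((T : ℝ) ^ (1 / 3 : ℝ)) ^ 2 :=
        total_regret_le hD.le hk hM hB.le (one_le_rpow_third hT) (blockSize_le hT)
          (numBlocks_le hT) hs.le hsN
    _ = _ := by rw [rpow_third_pow, Nat.cast_ofNat]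

end Regret

theorem proposition4_general (D r v : ℝ) (hD : 0 < D) (hr : 0 < r) (hv : 0 < v) :
    ∃ C : ℝ, ∀ (d : ℕ) (K : Set (EuclideanSpace ℝ (Fin d))) (c : EuclideanSpace ℝ (Fin d))
      (SO : EuclideanSpace ℝ (Fin d) → EuclideanSpace ℝ (Fin d)) (M₁ B₁ : ℝ)
      (T : ℕ) (hT : 1 ≤ T) (f : ℕ → EuclideanSpace ℝ (Fin d) → ℝ) (δ η : ℝ)
      (Ω : Type*) (_ : MeasurableSpace Ω) (P : Measure Ω)
      (z : ℕ → Ω → ℝ) (π : ℕ → Ω → Equiv.Perm (Fin (blockSize T)))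
      (o X : ℕ → Ω → EuclideanSpace ℝ (Fin d)),
      IsFeasibleSet K D →
      c ∈ K → Metric.ball c r ∩ (affineSpan ℝ K : Set (EuclideanSpace ℝ (Fin d))) ⊆ K →
      IsSeparationOracle K SO → Measurable SO →
      0 < B₁ →
      (∀ t < T, IsDRObjective K M₁ (f t)) →
      δ = v * (numBlocks T : ℝ) ^ (-(1 / 2) : ℝ) → δ ≤ r →
      η = v * r / (2 * B₁) * (numBlocks T : ℝ) ^ (-(1 / 2) : ℝ) →
      IsProbabilityMeasure P →
      (∀ t ω, X t ω = playedAction K c D SO δ η (blockSize_pos hT)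
        (fun q => z q ω) (fun q => π q ω) (fun s => o s ω) t) →
      IsSemiBanditRun P T B₁ f z π o X →
      (∀ t < T, (∀ᵐ ω ∂P, X t ω ∈ K) ∧ Integrable (fun ω => f t (X t ω)) P) ∧
      staticRegret P (Real.exp (-1)) K f X T ≤ C * (M₁ + B₁) * (T : ℝ) ^ (2 / 3 : ℝ) ∧
      adaptiveRegret P (Real.exp (-1)) K f X T ≤ C * (M₁ + B₁) * (T : ℝ) ^ (2 / 3 : ℝ) := by
  refine ⟨6 * D + 4 * baseRegretConst D r v, ?_⟩
  intro d K c SO M₁ B₁ T hT f δ η Ω _ P z π o X hK hcK hball hSO hSOm hB hf hδ hδr hη _ hX hrun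
  have hc : HasMargin K r c := hasMargin_of_ball_inter_affineSpan_subset hcK hball
  have hsqrt : (numBlocks T : ℝ) ^ (-(1 / 2) : ℝ) = (√(numBlocks T))⁻¹ := by
    rw [Real.rpow_neg (Nat.cast_nonneg _), Real.sqrt_eq_rpow]
  rw [hsqrt] at hδ hη
  have hN : (0 : ℝ) < numBlocks T := by exact_mod_cast numBlocks_pos hT
  have hδ₀ : 0 < δ := by rw [hδ]; positivity
  have h := isBlockingRun_baseIterate hK hf hrun hSO hSOm hδ₀ (hc.mono hδr) hX
  have hregret := fun a b (hb : b < T) =>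
    h.regretOn_Icc_le (hT := hT) (fun _ _ => rfl) hSO hc hD hr hv hB hδ hδr hη a hb
  exact ⟨fun t ht => ⟨h.ae_played_mem ht, h.integrable_played ht⟩,
    staticRegret_le hT hregret, adaptiveRegret_le hT hregret⟩

end

theorem proposition4 (D r v : ℝ) (hD : 0 < D) (hr : 0 < r) (hv : 0 < v) :
    ∃ C : ℝ, ∀ (d : ℕ) (K : Set (EuclideanSpace ℝ (Fin d))) (c : EuclideanSpace ℝ (Fin d))
      (SO : EuclideanSpace ℝ (Fin d) → EuclideanSpace ℝ (Fin d)) (M₁ B₁ Λ : ℝ)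
      (T : ℕ) (hT : 1 ≤ T) (f : ℕ → EuclideanSpace ℝ (Fin d) → ℝ) (δ η : ℝ)
      (Ω : Type*) (_ : MeasurableSpace Ω) (P : Measure Ω)
      (z : ℕ → Ω → ℝ) (π : ℕ → Ω → Equiv.Perm (Fin (blockSize T)))
      (o X : ℕ → Ω → EuclideanSpace ℝ (Fin d)),
      IsConstraintSet K D →
      c ∈ K → Metric.ball c r ∩ (affineSpan ℝ K : Set (EuclideanSpace ℝ (Fin d))) ⊆ K →
      IsSeparationOracle K SO → Measurable SO →
      0 < B₁ →
      (∀ t < T, IsObjective K M₁ Λ (f t)) →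
      δ = v * (numBlocks T : ℝ) ^ (-(1 / 2) : ℝ) → δ < r →
      η = v * r / (2 * B₁) * (numBlocks T : ℝ) ^ (-(1 / 2) : ℝ) →
      IsProbabilityMeasure P →
      (∀ t ω, X t ω = playedAction K c D SO δ η (blockSize_pos hT)
        (fun q => z q ω) (fun q => π q ω) (fun s => o s ω) t) →
      IsSemiBanditRun P T B₁ f z π o X →
      (∀ t < T, (∀ᵐ ω ∂P, X t ω ∈ K) ∧ Integrable (fun ω => f t (X t ω)) P) ∧
      staticRegret P (Real.exp (-1)) K f X T ≤ C * (M₁ + B₁) * (T : ℝ) ^ (2 / 3 : ℝ) ∧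
      adaptiveRegret P (Real.exp (-1)) K f X T ≤ C * (M₁ + B₁) * (T : ℝ) ^ (2 / 3 : ℝ) := by
  obtain ⟨C, hC⟩ := proposition4_general D r v hD hr hv
  exact ⟨C, fun d K c SO M₁ B₁ Λ T hT f δ η Ω _ P z π o X hK hc hball hSO hSOm hB hf hδ hδr =>
    hC d K c SO M₁ B₁ T hT f δ η Ω _ P z π o X hK.isFeasibleSet hc hball hSO hSOm hB
      (fun t ht => (hf t ht).isDRObjective) hδ hδr.le⟩
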